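/- Let $C$ be a finite set of candidates, let a vote be a subset $v\subseteq C$ (the approved candidates), let $V$ be a finite multiset of votes, and let $k$ be an integer. The SAV score of a committee $w\subseteq C$ at $(C,V)$ is $\sum_{v\in V,\,v\neq\emptyset}\frac{|v\cap w|}{|v|}$, and its NSAV score is $$\sum_{v\in V,\,v\neq\emptyset}\frac{|v\cap w|}{|v|}-\sum_{v\in V,\,v\neq C}\frac{|w\setminus v|}{|C|-|v|}.$$ For $\varphi\in\{\mathrm{SAV},\mathrm{NSAV}\}$ let $\varphi(C,V,k)$ be the collection of winning $k$-committees, that is, of the sets $w\subseteq C$ with $|w|=k$ that have the maximum $\varphi$ score among all $k$-subsets of $C$. In the problem Cardinality-Based Coalition Manipulation for $\varphi$ (CBCM-$\varphi$), the input consists of a set $C$ of candidates, two multisets $V$ and $V_{\mathrm M}$ of votes over $C$ (each listed vote by vote), and a winning committee $w\in\varphi(C,V\cup V_{\mathrm M},k)$, where $k=|w|$. The question is whether there is a multiset $U$ of $|V_{\mathrm M}|$ votes over $C$ such that for all $w'\in\varphi(C,V\cup U,k)$ and all $v\in V_{\mathrm M}$ it holds that $|v\cap w'|>|v\cap w|$.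 The problem Subset-Based Coalition Manipulation for $\varphi$ (SBCM-$\varphi$) is obtained by replacing $|v\cap w'|>|v\cap w|$ with $(v\cap w)\subsetneq(v\cap w')$. Theorem. For each $\varphi\in\{\mathrm{SAV},\mathrm{NSAV}\}$ and each constant $t$, CBCM-$\varphi$ and SBCM-$\varphi$, restricted to the inputs with at most $t$ manipulators ($|V_{\mathrm M}|\le t$), are solvable in polynomial time: for each of the two problems there is a Turing machine that decides all these inputs in a number of steps that is polynomial in the length of the input. -/

import Mathlib

namespace ApprovalVoting

section Elections

variable {C : Type} [Fintype C] [DecidableEq C]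

/-- The SAV score of the committee `w` in the election `(C, V)`: the sum over all nonempty votes
`v` of `|v ∩ w| / |v|`. -/
def savScore (V : Multiset (Finset C)) (w : Finset C) : ℚ :=
  ((V.filter fun v => v ≠ ∅).map fun v => ((v ∩ w).card : ℚ) / (v.card : ℚ)).sum

/-- The NSAV score of the committee `w` in the election `(C, V)`: its SAV score minus the sum over
all votes `v ≠ C` of `|w \ v| / (|C| - |v|)`. -/
def nsavScore (V : Multiset (Finset C)) (w : Finset C) : ℚ :=
  savScore V w -
    ((V.filter fun v => v ≠ Finset.univ).map fun v =>
      ((w \ v).card : ℚ) / ((Fintype.card C : ℚ) - (v.card : ℚ))).sum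

end Elections

/-- The two approval-based multiwinner voting rules considered. -/
inductive Rule : Type
  | SAV
  | NSAV

/-- The score that a rule assigns to the committee `w` in the election `(C, V)`. -/
def Rule.score {C : Type} [Fintype C] [DecidableEq C] :
    Rule → Multiset (Finset C) → Finset C → ℚ
  | Rule.SAV => savScore
  | Rule.NSAV => nsavScore

/-- `φ(C, V, k)`: the winning `k`-committees of the rule `φ` at the election `(C, V)`. -/
def Rule.winning {C : Type} [Fintype C] [DecidableEq C]
    (φ : Rule) (V : Multiset (Finset C)) (k : ℕ) : Set (Finset C) :=
  {w | w.card = k ∧ ∀ w' : Finset C, w'.card = k → φ.score V w' ≤ φ.score V w}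

/-- An input of the coalition manipulation problems for `φ`: candidates `0, …, m - 1`, the
nonmanipulative votes `V` and the manipulative votes `VM` (multisets, listed vote by vote), and a
committee `w` that is winning for `φ` at `(C, V ∪ VM)`. The committee size is `k = |w|`. -/
structure ManipulationInstance (φ : Rule) : Type where
  m : ℕ
  V : List (Finset (Fin m))
  VM : List (Finset (Fin m))
  w : Finset (Fin m)
  winning : w ∈ φ.winning ((V : Multiset (Finset (Fin m))) + (VM : Multiset (Finset (Fin m)))) w.card

namespace ManipulationInstance

variable {φ : Rule}

/-- Cardinality-Based Coalition Manipulation: can the manipulators replace their votes so that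
every manipulator has strictly more truthfully approved candidates in every new winning committee
than in `w`? -/
def CBCM (I : ManipulationInstance φ) : Prop :=
  ∃ U : Multiset (Finset (Fin I.m)), U.card = I.VM.length ∧
    ∀ w' ∈ φ.winning ((I.V : Multiset (Finset (Fin I.m))) + U) I.w.card,
      ∀ v ∈ I.VM, (v ∩ I.w).card < (v ∩ w').card

/-- Subset-Based Coalition Manipulation: as `CBCM`, with strict inclusion of `v ∩ w` in
`v ∩ w'` instead of the comparison of cardinalities. -/
def SBCM (I : ManipulationInstance φ) : Prop :=
  ∃ U : Multiset (Finset (Fin I.m)), U.card = I.VM.length ∧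
    ∀ w' ∈ φ.winning ((I.V : Multiset (Finset (Fin I.m))) + U) I.w.card,
      ∀ v ∈ I.VM, v ∩ I.w ⊂ v ∩ w'

end ManipulationInstance

/-- The input alphabet: two bits, and three marks that open a row of bits. -/
inductive InputSymbol : Type
  | zero
  | one
  | vote
  | manipulator
  | committee

/-- The membership bits of a set of candidates, in the order of the candidates. -/
def bits {m : ℕ} (s : Finset (Fin m)) : List InputSymbol :=
  List.ofFn fun i : Fin m => if i ∈ s then InputSymbol.one else InputSymbol.zero

/-- The input word of an instance: one marked row of `m` bits for every nonmanipulative vote, for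
every manipulative vote, and for the committee, a word of length
`(|V| + |VM| + 1) * (m + 1)`. -/
def ManipulationInstance.encode {φ : Rule} (I : ManipulationInstance φ) : List InputSymbol :=
  I.V.flatMap (fun v => InputSymbol.vote :: bits v) ++
    I.VM.flatMap (fun v => InputSymbol.manipulator :: bits v) ++
    InputSymbol.committee :: bits I.w

open Classical in
/-- The decision problem `P` on the instances in `α`, written as words by `enc`, is solved by a
Turing machine (with several stacks, one-symbol output) in a number of steps that is polynomial in
the length of the word. -/
def PolyTimeSolvable {α Γ : Type} (enc : α → List Γ) (P : α → Prop) : Prop :=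
  Nonempty (Turing.TM2ComputableInPolyTime enc Computability.encodeBool fun a => decide (P a))

end ApprovalVoting

/-! Fix the sizes of the new votes. The score of a candidate then depends only on the fixed votes
and on the set of manipulators approving it, and choosing the new votes means choosing such a set
for every candidate. Up to a term that is the same for all committees of one size, a vote `v` gives
each of its candidates `1/|v|` under SAV, and `1/|v| + 1/(m - |v|)` under NSAV. Multiplication by
`m!` turns these scores into natural numbers (`Rule.score_eq`).

A committee of size `k` wins exactly when it contains all candidates above a threshold and otherwise
only candidates at the threshold (`maximal_iff_between`); the threshold can be taken to be the score
of some candidate (`exists_threshold`). Whether all these committees satisfy a manipulator is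
decided by the worst of them, so it is a condition on a few cardinalities
(`forall_between_card_lt_iff`, `forall_between_subset_iff`). For `t` manipulators there are `2 + 5t`
counters in all, each at most `m`.

The algorithm tries all vote sizes and all thresholds, a threshold being given by a candidate and a
set of approvers. For each guess a dynamic program runs through the candidates and keeps the
reachable vectors of counters (`mem_reach`). For constant `t` there are polynomially many guesses
and vectors. Correctness is `solveExact_rows_iff_exists`.

For the running time, structured stack programs compile to Turing machines with the same number of
steps (`Run.stepsTo`). On data coded by binary trees they yield a class `PolyFun` that is closed
under composition, pairing, case distinction and folds with polynomially bounded accumulators. The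
algorithm is written with these operations, and `PolyFun.polyTimeSolvable` adds the reading of the
input and the writing of the answer. -/

open Turing

/-! ### Structured stack programs and their compilation to Turing machines -/

/-- Structured programs over a family of stacks with symbols `Γ` and a register with values `σ`. -/
inductive StackProg {K : Type} (Γ : K → Type) (σ : Type) : Type
  | push (k : K) (f : σ → Γ k) : StackProg Γ σ
  | pop (k : K) (f : σ → Option (Γ k) → σ) : StackProg Γ σ
  | load (f : σ → σ) : StackProg Γ σ
  | seq (p q : StackProg Γ σ) : StackProg Γ σ
  | ite (b : σ → Bool) (p q : StackProg Γ σ) : StackProg Γ σ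
  | loop (b : σ → Bool) (p : StackProg Γ σ) : StackProg Γ σ

namespace StackProg

variable {K : Type} {Γ : K → Type} {σ : Type}

/-- The control points of a program. -/
def Label : StackProg Γ σ → Type
  | push _ _ => Unit
  | pop _ _ => Unit
  | load _ => Unit
  | seq p q => Label p ⊕ Label q
  | ite _ p q => Option (Label p ⊕ Label q)
  | loop _ p => Option (Label p)

instance Label.fintype : ∀ p : StackProg Γ σ, Fintype (Label p)
  | push _ _ => inferInstanceAs (Fintype Unit)
  | pop _ _ => inferInstanceAs (Fintype Unit)
  | load _ => inferInstanceAs (Fintype Unit)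
  | seq p q =>
    have := Label.fintype p
    have := Label.fintype q
    inferInstanceAs (Fintype (Label p ⊕ Label q))
  | ite _ p q =>
    have := Label.fintype p
    have := Label.fintype q
    inferInstanceAs (Fintype (Option (Label p ⊕ Label q)))
  | loop _ p =>
    have := Label.fintype p
    inferInstanceAs (Fintype (Option (Label p)))

/-- The first control point of a program. -/
def start : ∀ p : StackProg Γ σ, Label p
  | push _ _ => ()
  | pop _ _ => ()
  | load _ => ()
  | seq p _ => Sum.inl (start p)
  | ite _ _ _ => none
  | loop _ _ => none

/-- The machine code of a program whose control points are placed at `ι` and which continues at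
`exit`. -/
def code {Λ : Type} : ∀ p : StackProg Γ σ, (Label p → Λ) → Λ → Label p → TM2.Stmt Γ Λ σ
  | push k f, _, exit, _ => .push k f (.goto fun _ => exit)
  | pop k f, _, exit, _ => .pop k f (.goto fun _ => exit)
  | load f, _, exit, _ => .load f (.goto fun _ => exit)
  | seq p q, ι, _, Sum.inl l => code p (fun l => ι (Sum.inl l)) (ι (Sum.inr (start q))) l
  | seq _ q, ι, exit, Sum.inr l => code q (fun l => ι (Sum.inr l)) exit l
  | ite b p q, ι, _, none =>
    .branch b (.goto fun _ => ι (some (Sum.inl (start p))))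
      (.goto fun _ => ι (some (Sum.inr (start q))))
  | ite _ p _, ι, exit, some (Sum.inl l) => code p (fun l => ι (some (Sum.inl l))) exit l
  | ite _ _ q, ι, exit, some (Sum.inr l) => code q (fun l => ι (some (Sum.inr l))) exit l
  | loop b p, ι, exit, none =>
    .branch b (.goto fun _ => ι (some (start p))) (.goto fun _ => exit)
  | loop _ p, ι, _, some l => code p (fun l => ι (some l)) (ι none) l

variable [DecidableEq K]

/-- Big-step semantics with the number of steps. -/
inductive Run : StackProg Γ σ → σ → (∀ k, List (Γ k)) → σ → (∀ k, List (Γ k)) → ℕ → Prop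
  | push {k f v S} : Run (push k f) v S v (Function.update S k (f v :: S k)) 1
  | pop {k f v S} :
    Run (pop k f) v S (f v (S k).head?) (Function.update S k (S k).tail) 1
  | load {f v S} : Run (load f) v S (f v) S 1
  | seq {p q v S v' S' v'' S'' n n'} : Run p v S v' S' n → Run q v' S' v'' S'' n' →
    Run (seq p q) v S v'' S'' (n + n')
  | iteTrue {b p q v S v' S' n} : b v = true → Run p v S v' S' n →
    Run (ite b p q) v S v' S' (1 + n)
  | iteFalse {b p q v S v' S' n} : b v = false → Run q v S v' S' n →
    Run (ite b p q) v S v' S' (1 + n)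
  | loopDone {b p v S} : b v = false → Run (loop b p) v S v S 1
  | loopStep {b p v S v' S' v'' S'' n n'} : b v = true → Run p v S v' S' n →
    Run (loop b p) v' S' v'' S'' n' → Run (loop b p) v S v'' S'' (1 + n + n')

/-- `M` goes from one configuration to the other in exactly `n` steps. -/
def StepsTo {Λ : Type} (M : Λ → TM2.Stmt Γ Λ σ) (c c' : TM2.Cfg Γ Λ σ) (n : ℕ) : Prop :=
  (flip bind (TM2.step M))^[n] (some c) = some c'

theorem StepsTo.trans {Λ : Type} {M : Λ → TM2.Stmt Γ Λ σ} {c c' c'' : TM2.Cfg Γ Λ σ} {n n' : ℕ}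
    (h : StepsTo M c c' n) (h' : StepsTo M c' c'' n') : StepsTo M c c'' (n + n') := by
  unfold StepsTo at *
  rw [add_comm, Function.iterate_add_apply, h, h']

theorem StepsTo.single {Λ : Type} {M : Λ → TM2.Stmt Γ Λ σ} {l : Λ} {v : σ} {S : ∀ k, List (Γ k)}
    {c : TM2.Cfg Γ Λ σ} (h : TM2.stepAux (M l) v S = c) : StepsTo M ⟨some l, v, S⟩ c 1 := by
  simp [StepsTo, flip, TM2.step, h]

/-- Induction on the run. The placement `ι` of the control points and the exit are arbitrary, so
that the induction hypothesis applies to subprograms embedded in a larger machine. -/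
theorem Run.stepsTo {p : StackProg Γ σ} {v : σ} {S : ∀ k, List (Γ k)} {v' : σ}
    {S' : ∀ k, List (Γ k)} {n : ℕ} (h : Run p v S v' S' n) :
    ∀ {Λ : Type} (M : Λ → TM2.Stmt Γ Λ σ) (ι : Label p → Λ) (exit : Λ),
      (∀ l, M (ι l) = code p ι exit l) →
      StepsTo M ⟨some (ι (start p)), v, S⟩ ⟨some exit, v', S'⟩ n := by
  induction h with
  | push => intro Λ M ι exit hM; exact StepsTo.single (by rw [hM]; rfl)
  | pop => intro Λ M ι exit hM; exact StepsTo.single (by rw [hM]; rfl)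
  | load => intro Λ M ι exit hM; exact StepsTo.single (by rw [hM]; rfl)
  | seq _ _ ih ih' =>
    intro Λ M ι exit hM
    exact (ih M _ _ fun l => hM (Sum.inl l)).trans (ih' M _ _ fun l => hM (Sum.inr l))
  | @iteTrue b p q v S _ _ _ hb _ ih =>
    intro Λ M ι exit hM
    refine StepsTo.trans (StepsTo.single ?_) (ih M _ _ fun l => hM (some (Sum.inl l)))
    rw [hM]
    simp [start, code, hb]
  | @iteFalse b p q v S _ _ _ hb _ ih =>
    intro Λ M ι exit hM
    refine StepsTo.trans (StepsTo.single ?_) (ih M _ _ fun l => hM (some (Sum.inr l)))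
    rw [hM]
    simp [start, code, hb]
  | loopDone hb =>
    intro Λ M ι exit hM
    refine StepsTo.single ?_
    rw [hM]
    simp [start, code, hb]
  | @loopStep b p _ _ _ _ _ _ _ _ hb _ _ ih ih' =>
    intro Λ M ι exit hM
    refine StepsTo.trans (StepsTo.trans (StepsTo.single ?_) (ih M _ _ fun l => hM (some l)))
      (ih' M _ _ hM)
    rw [hM]
    simp [start, code, hb]

/-- From every register value, the program turns the stacks `S` into `S'` in at most `T` steps. -/
def Exec (p : StackProg Γ σ) (S S' : ∀ k, List (Γ k)) (T : ℕ) : Prop :=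
  ∀ v, ∃ v' n, n ≤ T ∧ Run p v S v' S' n

/-- As `Exec`, and the final register value is `v'`. -/
def ExecTo (p : StackProg Γ σ) (S : ∀ k, List (Γ k)) (v' : σ) (S' : ∀ k, List (Γ k)) (T : ℕ) :
    Prop :=
  ∀ v, ∃ n, n ≤ T ∧ Run p v S v' S' n

theorem ExecTo.exec {p : StackProg Γ σ} {S S' : ∀ k, List (Γ k)} {v' : σ} {T : ℕ}
    (h : ExecTo p S v' S' T) : Exec p S S' T := fun v => ⟨v', h v⟩

theorem Exec.mono {p : StackProg Γ σ} {S S' : ∀ k, List (Γ k)} {T T' : ℕ}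
    (h : Exec p S S' T) (hT : T ≤ T') : Exec p S S' T' := fun v => by
  obtain ⟨v', n, hn, hr⟩ := h v
  exact ⟨v', n, hn.trans hT, hr⟩

theorem Exec.seq {p q : StackProg Γ σ} {S S' S'' : ∀ k, List (Γ k)} {T T' : ℕ}
    (h : Exec p S S' T) (h' : Exec q S' S'' T') : Exec (seq p q) S S'' (T + T') := fun v => by
  obtain ⟨v', n, hn, hr⟩ := h v
  obtain ⟨v'', n', hn', hr'⟩ := h' v'
  exact ⟨v'', n + n', by omega, hr.seq hr'⟩

/-- A branch looks at the register, so the program before it must leave a known register value;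
hence `ExecTo` instead of `Exec`. -/
theorem ExecTo.seq_iteTrue {p q r : StackProg Γ σ} {b : σ → Bool} {S S' S'' : ∀ k, List (Γ k)}
    {v : σ} {T T' : ℕ} (h : ExecTo p S v S' T) (hb : b v = true) (h' : Exec q S' S'' T') :
    Exec (.seq p (.ite b q r)) S S'' (T + T' + 1) := fun w => by
  obtain ⟨n, hn, hr⟩ := h w
  obtain ⟨v'', n', hn', hr'⟩ := h' v
  exact ⟨v'', n + (1 + n'), by omega, hr.seq (.iteTrue hb hr')⟩

theorem ExecTo.seq_iteFalse {p q r : StackProg Γ σ} {b : σ → Bool} {S S' S'' : ∀ k, List (Γ k)}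
    {v : σ} {T T' : ℕ} (h : ExecTo p S v S' T) (hb : b v = false) (h' : Exec r S' S'' T') :
    Exec (.seq p (.ite b q r)) S S'' (T + T' + 1) := fun w => by
  obtain ⟨n, hn, hr⟩ := h w
  obtain ⟨v'', n', hn', hr'⟩ := h' v
  exact ⟨v'', n + (1 + n'), by omega, hr.seq (.iteFalse hb hr')⟩

/-- Run `p`, and as long as the register satisfies `b` run `q` and then `p` again. -/
def whileDo (p : StackProg Γ σ) (b : σ → Bool) (q : StackProg Γ σ) : StackProg Γ σ :=
  .seq p (.loop b (.seq q p))

theorem ExecTo.whileDo_done {p q : StackProg Γ σ} {b : σ → Bool} {S S' : ∀ k, List (Γ k)}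
    {v : σ} {T : ℕ} (h : ExecTo p S v S' T) (hb : b v = false) :
    Exec (whileDo p b q) S S' (T + 1) := fun w => by
  obtain ⟨n, hn, hr⟩ := h w
  exact ⟨v, n + 1, by omega, hr.seq (.loopDone hb)⟩

theorem ExecTo.whileDo_step {p q : StackProg Γ σ} {b : σ → Bool} {S S' S'' S₃ : ∀ k, List (Γ k)}
    {v : σ} {T T' T'' : ℕ} (h : ExecTo p S v S' T) (hb : b v = true)
    (h' : ∃ v' n, n ≤ T' ∧ Run q v S' v' S'' n) (h'' : Exec (whileDo p b q) S'' S₃ T'') :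
    Exec (whileDo p b q) S S₃ (T + T' + T'' + 1) := fun w => by
  obtain ⟨n, hn, hr⟩ := h w
  obtain ⟨v', n', hn', hr'⟩ := h'
  obtain ⟨v'', n'', hn'', hr''⟩ := h'' v'
  unfold whileDo at *
  -- The first `p` of the remaining loop becomes the last `p` of the loop body just executed.
  cases hr'' with
  | @seq _ _ _ _ v₁ S₁ _ _ n₁ n₂ h₁ h₂ =>
    exact ⟨v'', n + (1 + (n' + n₁) + n₂), by omega, hr.seq (.loopStep hb (hr'.seq h₁) h₂)⟩

end StackProg

/-! ### Moving prefix codes of trees between stacks -/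

/-- Binary trees, the data of the programs below. -/
inductive BinTree : Type
  | leaf : BinTree
  | node (l r : BinTree) : BinTree

/-- The prefix code of a tree. -/
def BinTree.code : BinTree → List Bool
  | leaf => [false]
  | node l r => true :: (code l ++ code r)

namespace TreeMachine

open ApprovalVoting StackProg

/-- The stacks: the input, the data stack, a stack for saved data, a scratch stack, a counter. -/
inductive Stack : Type
  | inp
  | main
  | aux
  | tmp
  | cnt
  deriving DecidableEq

instance : Fintype Stack :=
  ⟨{.inp, .main, .aux, .tmp, .cnt}, fun k => by cases k <;> decide⟩

/-- The symbols of the stacks. -/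
def Sym : Stack → Type
  | .inp => InputSymbol
  | .main => Bool
  | .aux => Option Bool
  | .tmp => Bool
  | .cnt => Unit

deriving instance DecidableEq for ApprovalVoting.InputSymbol

instance : Fintype ApprovalVoting.InputSymbol :=
  ⟨{.zero, .one, .vote, .manipulator, .committee}, fun s => by cases s <;> decide⟩

/-- The register holds the last symbol that was read, with the bits as input symbols. -/
abbrev Reg : Type := Option InputSymbol

/-- Programs on the tree machine. -/
abbrev TreeProg : Type := StackProg Sym Reg

/-- A bit as a register value. -/
def Reg.ofBool (b : Bool) : Reg := some (if b then .one else .zero)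

/-- The bit in the register. -/
def Reg.bit (v : Reg) : Bool := decide (v = some .one)

@[simp] theorem Reg.bit_ofBool (b : Bool) : Reg.bit (Reg.ofBool b) = b := by cases b <;> rfl

/-- The contents of all the stacks. -/
def stk (i : List InputSymbol) (m : List Bool) (a : List (Option Bool)) (b : List Bool)
    (c : List Unit) : ∀ k, List (Sym k)
  | .inp => i
  | .main => m
  | .aux => a
  | .tmp => b
  | .cnt => c

/-- Push on the data stack. -/
def pushMain (f : Reg → Bool) : TreeProg := .push .main f
/-- Push on the stack for saved data. -/
def pushAux (f : Reg → Option Bool) : TreeProg := .push .aux f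
/-- Push on the scratch stack. -/
def pushTmp (f : Reg → Bool) : TreeProg := .push .tmp f
/-- Increase the counter. -/
def pushCnt : TreeProg := .push .cnt fun _ => ()
/-- Pop the input. -/
def popInp : TreeProg := .pop .inp fun _ x => x
/-- Pop the data stack. -/
def popMain : TreeProg := .pop .main fun _ x => x.bind Reg.ofBool
/-- Pop the stack for saved data. -/
def popAux : TreeProg := .pop .aux fun _ (x : Option (Option Bool)) => x.join.bind Reg.ofBool
/-- Pop the scratch stack. -/
def popTmp : TreeProg := .pop .tmp fun _ x => x.bind Reg.ofBool
/-- Decrease the counter. -/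
def popCnt : TreeProg := .pop .cnt fun _ (x : Option Unit) => x.map fun _ => InputSymbol.one
/-- Do nothing. -/
def skip : TreeProg := .load id

section Basic

variable {i : List InputSymbol} {m : List Bool} {a : List (Option Bool)} {b : List Bool}
  {c : List Unit} {v : Reg}

theorem run_skip {S : ∀ k, List (Sym k)} : Run skip v S v S 1 := Run.load

theorem run_pushMain {f : Reg → Bool} :
    Run (pushMain f) v (stk i m a b c) v (stk i (f v :: m) a b c) 1 := by
  have : stk i (f v :: m) a b c = Function.update (stk i m a b c) .main (f v :: m) := by
    funext k; cases k <;> rfl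
  rw [this]; exact Run.push

theorem run_pushAux {f : Reg → Option Bool} :
    Run (pushAux f) v (stk i m a b c) v (stk i m (f v :: a) b c) 1 := by
  have : stk i m (f v :: a) b c = Function.update (stk i m a b c) .aux (f v :: a) := by
    funext k; cases k <;> rfl
  rw [this]; exact Run.push

theorem run_pushTmp {f : Reg → Bool} :
    Run (pushTmp f) v (stk i m a b c) v (stk i m a (f v :: b) c) 1 := by
  have : stk i m a (f v :: b) c = Function.update (stk i m a b c) .tmp (f v :: b) := by
    funext k; cases k <;> rfl
  rw [this]; exact Run.push

theorem run_pushCnt :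
    Run pushCnt v (stk i m a b c) v (stk i m a b (() :: c)) 1 := by
  have : stk i m a b (() :: c) = Function.update (stk i m a b c) .cnt (() :: c) := by
    funext k; cases k <;> rfl
  rw [this]; exact Run.push

theorem run_popInp : Run popInp v (stk i m a b c) i.head? (stk i.tail m a b c) 1 := by
  have : stk i.tail m a b c = Function.update (stk i m a b c) .inp i.tail := by
    funext k; cases k <;> rfl
  rw [this]; exact Run.pop

theorem run_popMain :
    Run popMain v (stk i m a b c) (m.head?.bind Reg.ofBool) (stk i m.tail a b c) 1 := by
  have : stk i m.tail a b c = Function.update (stk i m a b c) .main m.tail := by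
    funext k; cases k <;> rfl
  rw [this]; exact Run.pop

theorem run_popAux :
    Run popAux v (stk i m a b c) (a.head?.join.bind Reg.ofBool) (stk i m a.tail b c) 1 := by
  have : stk i m a.tail b c = Function.update (stk i m a b c) .aux a.tail := by
    funext k; cases k <;> rfl
  rw [this]; exact Run.pop

theorem run_popTmp :
    Run popTmp v (stk i m a b c) (b.head?.bind Reg.ofBool) (stk i m a b.tail c) 1 := by
  have : stk i m a b.tail c = Function.update (stk i m a b c) .tmp b.tail := by
    funext k; cases k <;> rfl
  rw [this]; exact Run.pop

theorem run_popCnt :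
    Run popCnt v (stk i m a b c) (c.head?.map fun _ => InputSymbol.one)
      (stk i m a b c.tail) 1 := by
  have : stk i m a b c.tail = Function.update (stk i m a b c) .cnt c.tail := by
    funext k; cases k <;> rfl
  rw [this]; exact Run.pop

end Basic

/-- Move one symbol of a tree from the data stack to the chosen stacks. -/
def scanStep (x y : Bool) : TreeProg :=
  .seq popMain (.seq (.ite Reg.bit (.seq pushCnt pushCnt) skip)
    (.seq (if x then pushAux fun v => some v.bit else skip) (if y then pushTmp Reg.bit else skip)))

/-- Remove a tree from the data stack; its code goes reversed to the chosen stacks. -/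
def scan (x y : Bool) : TreeProg :=
  .seq pushCnt (whileDo popCnt Option.isSome (scanStep x y))

section Scan

variable {i : List InputSymbol} {m : List Bool} {a : List (Option Bool)} {b : List Bool}
  {c : List Unit}

theorem run_scanStep (x y s : Bool) (v : Reg) :
    ∃ v' n, n ≤ 8 ∧ Run (scanStep x y) v (stk i (s :: m) a b c) v'
      (stk i m (if x then some s :: a else a) (if y then s :: b else b)
        (if s then () :: () :: c else c)) n := by
  have h₁ : Run popMain v (stk i (s :: m) a b c) (Reg.ofBool s) (stk i m a b c) 1 :=
    run_popMain
  have h₂ : ∃ n, n ≤ 3 ∧ Run (.ite Reg.bit (.seq pushCnt pushCnt) skip) (Reg.ofBool s)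
      (stk i m a b c) (Reg.ofBool s) (stk i m a b (if s then () :: () :: c else c)) n := by
    cases s
    · exact ⟨_, by omega, .iteFalse rfl run_skip⟩
    · exact ⟨_, le_rfl, .iteTrue rfl (.seq run_pushCnt run_pushCnt)⟩
  obtain ⟨n, hn, h₂⟩ := h₂
  refine ⟨_, _, ?_, h₁.seq (h₂.seq (.seq (n := 1) (n' := 1)
    (v' := Reg.ofBool s) (v'' := Reg.ofBool s)
    (S' := stk i m (if x then some s :: a else a) b (if s then () :: () :: c else c)) ?_ ?_))⟩
  · omega
  · cases x
    · exact run_skip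
    · have := run_pushAux (i := i) (m := m) (a := a) (b := b) (v := Reg.ofBool s)
        (c := if s then () :: () :: c else c) (f := fun v => some v.bit)
      simpa using this
  · cases y
    · exact run_skip
    · have := run_pushTmp (i := i) (m := m) (a := if x then some s :: a else a) (b := b)
        (v := Reg.ofBool s) (c := if s then () :: () :: c else c) (f := Reg.bit)
      simpa using this

theorem exec_scanStep_loop {x y s : Bool} {S : ∀ k, List (Sym k)} {T : ℕ}
    (h : Exec (whileDo popCnt Option.isSome (scanStep x y))
      (stk i m (if x then some s :: a else a) (if y then s :: b else b)
        (if s then () :: () :: c else c)) S T) :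
    Exec (whileDo popCnt Option.isSome (scanStep x y))
      (stk i (s :: m) a b (() :: c)) S (T + 10) := by
  refine (ExecTo.whileDo_step (v := some .one) (S' := stk i (s :: m) a b c) (T := 1)
    (fun v => ⟨1, le_rfl, run_popCnt⟩) rfl (run_scanStep x y s _) h).mono (by omega)

/-- The counter is the number of trees still to be read: each symbol consumes one, and a node symbol
adds two. Stating the claim with an arbitrary continuation `S` lets the induction treat the two
subtrees one after the other. -/
theorem exec_scan_loop (x y : Bool) (t : BinTree) :
    ∀ {m : List Bool} {a : List (Option Bool)} {b : List Bool} {c : List Unit}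
      {S : ∀ k, List (Sym k)} {T : ℕ},
      Exec (whileDo popCnt Option.isSome (scanStep x y))
        (stk i m (if x then t.code.reverse.map some ++ a else a)
          (if y then t.code.reverse ++ b else b) c) S T →
      Exec (whileDo popCnt Option.isSome (scanStep x y))
        (stk i (t.code ++ m) a b (() :: c)) S (T + 10 * t.code.length) := by
  induction t with
  | leaf =>
    intro m a b c S T h
    exact exec_scanStep_loop (by simpa [BinTree.code] using h)
  | node l r ihl ihr =>
    intro m a b c S T h
    have := exec_scanStep_loop (i := i) (x := x) (y := y) (s := true) (a := a) (b := b) (c := c)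
      (m := l.code ++ (r.code ++ m)) (ihl (ihr (S := S) (T := T) ?_))
    · refine Exec.mono (by simpa [BinTree.code] using this) ?_
      simp [BinTree.code]
      omega
    · cases x <;> cases y <;> simpa [BinTree.code] using h

theorem exec_scan (x y : Bool) (t : BinTree) :
    Exec (scan x y) (stk i (t.code ++ m) a b [])
      (stk i m (if x then t.code.reverse.map some ++ a else a)
        (if y then t.code.reverse ++ b else b) []) (3 + 10 * t.code.length) := by
  refine (Exec.seq (T := 1) (fun v => ⟨v, 1, le_rfl, run_pushCnt⟩)
    (exec_scan_loop x y t (ExecTo.whileDo_done (v := none) (T := 1)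
      (fun v => ⟨1, le_rfl, run_popCnt⟩) rfl))).mono (by omega)

end Scan

/-- Move saved symbols back to the data stack. -/
def restore : TreeProg := whileDo popAux Option.isSome (pushMain Reg.bit)

/-- Move the scratch stack to the data stack. -/
def drain : TreeProg := whileDo popTmp Option.isSome (pushMain Reg.bit)

/-- Save the tree at the top of the data stack. -/
def save : TreeProg := .seq (pushAux fun _ => none) (scan true false)

/-- Delete the tree at the top of the data stack. -/
def drop : TreeProg := scan false false

/-- Duplicate the tree at the top of the data stack. -/
def dup : TreeProg := .seq (pushAux fun _ => none) (.seq (scan true true) (.seq restore drain))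

/-- Push a word on the data stack. -/
def pushAll : List Bool → TreeProg
  | [] => skip
  | x :: l => .seq (pushAll l) (pushMain fun _ => x)

section Moves

variable {i : List InputSymbol} {m : List Bool} {a : List (Option Bool)} {b : List Bool}
  {c : List Unit}

theorem exec_skip {S : ∀ k, List (Sym k)} : Exec skip S S 1 := fun v => ⟨v, 1, le_rfl, run_skip⟩

theorem exec_pushMain (x : Bool) :
    Exec (pushMain fun _ => x) (stk i m a b c) (stk i (x :: m) a b c) 1 :=
  fun v => ⟨v, 1, le_rfl, run_pushMain⟩

theorem execTo_popMain (x : Bool) :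
    ExecTo popMain (stk i (x :: m) a b c) (Reg.ofBool x) (stk i m a b c) 1 :=
  fun _ => ⟨1, le_rfl, run_popMain⟩

/-- The `none` below the saved symbols stops the loop, so that older saved data stays untouched. -/
theorem exec_restore (l : List Bool) : ∀ {m : List Bool},
    Exec restore (stk i m (l.map some ++ none :: a) b c) (stk i (l.reverse ++ m) a b c)
      (3 * l.length + 2) := by
  induction l with
  | nil =>
    intro m
    exact ExecTo.whileDo_done (v := none) (T := 1) (fun v => ⟨1, le_rfl, run_popAux⟩) rfl
  | cons x l ih =>
    intro m
    have hp : Run (pushMain Reg.bit) (Reg.ofBool x) (stk i m (l.map some ++ none :: a) b c)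
        (Reg.ofBool x) (stk i (x :: m) (l.map some ++ none :: a) b c) 1 := by
      simpa using run_pushMain (f := Reg.bit) (v := Reg.ofBool x) (i := i) (m := m)
        (a := l.map some ++ none :: a) (b := b) (c := c)
    have := ExecTo.whileDo_step (p := popAux) (b := Option.isSome) (v := Reg.ofBool x)
      (S := stk i m (some x :: (l.map some ++ none :: a)) b c) (T := 1) (T' := 1)
      (fun v => ⟨1, le_rfl, run_popAux⟩) rfl ⟨_, 1, le_rfl, hp⟩ ih
    refine Exec.mono (by simpa [restore] using this) (by simp; omega)

theorem exec_drain (l : List Bool) : ∀ {m : List Bool},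
    Exec drain (stk i m a l c) (stk i (l.reverse ++ m) a [] c) (3 * l.length + 2) := by
  induction l with
  | nil =>
    intro m
    exact ExecTo.whileDo_done (v := none) (T := 1) (fun v => ⟨1, le_rfl, run_popTmp⟩) rfl
  | cons x l ih =>
    intro m
    have hp : Run (pushMain Reg.bit) (Reg.ofBool x) (stk i m a l c)
        (Reg.ofBool x) (stk i (x :: m) a l c) 1 := by
      simpa using run_pushMain (f := Reg.bit) (v := Reg.ofBool x) (i := i) (m := m)
        (a := a) (b := l) (c := c)
    have := ExecTo.whileDo_step (p := popTmp) (b := Option.isSome) (v := Reg.ofBool x)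
      (S := stk i m a (x :: l) c) (T := 1) (T' := 1)
      (fun v => ⟨1, le_rfl, run_popTmp⟩) rfl ⟨_, 1, le_rfl, hp⟩ ih
    refine Exec.mono (by simpa [drain] using this) (by simp; omega)

theorem exec_save (t : BinTree) :
    Exec save (stk i (t.code ++ m) a b [])
      (stk i m (t.code.reverse.map some ++ none :: a) b []) (4 + 10 * t.code.length) :=
  (Exec.seq (T := 1) (fun v => ⟨v, 1, le_rfl, run_pushAux⟩) (exec_scan true false t)).mono
    (by omega)

theorem exec_restore_code (t : BinTree) :
    Exec restore (stk i m (t.code.reverse.map some ++ none :: a) b c)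
      (stk i (t.code ++ m) a b c) (3 * t.code.length + 2) := by
  simpa using exec_restore (i := i) (a := a) (b := b) (c := c) t.code.reverse (m := m)

theorem exec_drop (t : BinTree) :
    Exec drop (stk i (t.code ++ m) a b []) (stk i m a b []) (3 + 10 * t.code.length) :=
  exec_scan false false t

theorem exec_dup (t : BinTree) :
    Exec dup (stk i (t.code ++ m) a [] []) (stk i (t.code ++ (t.code ++ m)) a [] [])
      (8 + 16 * t.code.length) := by
  refine (Exec.seq (T := 1) (fun v => ⟨v, 1, le_rfl, run_pushAux⟩)
    ((exec_scan true true t).seq ((exec_restore_code t).seq (?_ : Exec _ _ _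
      (3 * t.code.length + 2))))).mono (by omega)
  simpa using exec_drain (i := i) (a := a) (c := []) t.code.reverse (m := t.code ++ m)

theorem exec_pushAll (l : List Bool) :
    Exec (pushAll l) (stk i m a b c) (stk i (l ++ m) a b c) (l.length + 1) := by
  induction l with
  | nil => exact exec_skip
  | cons x l ih => exact ih.seq (exec_pushMain x)

end Moves

end TreeMachine

/-! ### Data coded by trees, and the sizes of the codes -/

/-- An encoding of the elements of a type by binary trees. -/
class TreeEnc (α : Type) where
  /-- the tree of an element -/
  enc : α → BinTree

namespace TreeEnc

/-- The code of an element. -/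
def word {α : Type} [TreeEnc α] (a : α) : List Bool := (enc a).code

/-- The size of the code of an element. -/
def size {α : Type} [TreeEnc α] (a : α) : ℕ := (word a).length

variable {α β : Type} [TreeEnc α] [TreeEnc β]

instance : TreeEnc (α × β) := ⟨fun p => .node (enc p.1) (enc p.2)⟩

/-- The tree of a list. -/
def encList : List α → BinTree
  | [] => .leaf
  | a :: l => .node (enc a) (encList l)

instance : TreeEnc (List α) := ⟨encList⟩

instance : TreeEnc Bool := ⟨fun b => if b then .node .leaf .leaf else .leaf⟩

instance : TreeEnc Unit := ⟨fun _ => .leaf⟩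

instance : TreeEnc ℕ := ⟨fun n => enc (Nat.bits n)⟩

theorem word_pair (a : α) (b : β) : word (a, b) = true :: (word a ++ word b) := rfl

theorem word_cons (a : α) (l : List α) : word (a :: l) = true :: (word a ++ word l) := rfl

@[simp] theorem size_pair (a : α) (b : β) : size (a, b) = size a + size b + 1 := by
  simp [size, word_pair]

@[simp] theorem size_nil : size ([] : List α) = 1 := rfl

@[simp] theorem size_cons (a : α) (l : List α) : size (a :: l) = size a + size l + 1 := by
  simp [size, word_cons]

theorem size_pos (a : α) : 1 ≤ size a := by
  unfold size word
  cases enc a <;> simp [BinTree.code]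

theorem size_bool_le (b : Bool) : size b ≤ 3 := by cases b <;> decide

theorem size_append (l l' : List α) : size (l ++ l') + 1 = size l + size l' := by
  induction l with
  | nil => simp; omega
  | cons a l ih => simp; omega

theorem size_reverse (l : List α) : size l.reverse = size l := by
  induction l with
  | nil => rfl
  | cons a l ih =>
    have := size_append l.reverse [a]
    simp at *
    omega

theorem size_le_of_sublist {l l' : List α} (h : List.Sublist l l') : size l ≤ size l' := by
  induction h with
  | slnil => rfl
  | cons a _ ih => simp; omega
  | cons_cons a _ ih => simp; omega

theorem size_le_of_mem {l : List α} {a : α} (h : a ∈ l) : size a + 2 ≤ size l := by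
  have := size_le_of_sublist (List.singleton_sublist.2 h)
  simp at this
  omega

theorem length_lt_size (l : List α) : l.length < size l := by
  induction l with
  | nil => simp
  | cons a l ih => simp; omega

theorem size_le_of_forall {l : List α} {B : ℕ} (h : ∀ a ∈ l, size a ≤ B) :
    size l ≤ l.length * (B + 1) + 1 := by
  induction l with
  | nil => simp
  | cons a l ih =>
    have h₁ := h a (by simp)
    have h₂ := ih fun b hb => h b (by simp [hb])
    simp only [size_cons, List.length_cons, add_mul]
    omega

end TreeEnc

open TreeEnc TreeMachine StackProg

/-! ### Polynomial bounds in the size of the argument -/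

section PolyBdd

variable {α β : Type} [TreeEnc α] [TreeEnc β]

/-- The quantity `g` is polynomially bounded in the size of its argument. -/
def PolyBdd (g : α → ℕ) : Prop := ∃ P : Polynomial ℕ, ∀ a, g a ≤ P.eval (size a)

theorem Polynomial.eval_nat_mono (P : Polynomial ℕ) : Monotone fun n => P.eval n := by
  intro a b h
  simp only [Polynomial.eval_eq_sum, Polynomial.sum]
  gcongr

namespace PolyBdd

theorem of_le {f g : α → ℕ} (hg : PolyBdd g) (h : ∀ a, f a ≤ g a) : PolyBdd f := by
  obtain ⟨P, hP⟩ := hg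
  exact ⟨P, fun a => (h a).trans (hP a)⟩

theorem const (c : ℕ) : PolyBdd fun _ : α => c := ⟨.C c, fun a => by simp⟩

theorem sizeOf : PolyBdd fun a : α => size a := ⟨.X, fun a => by simp⟩

theorem add {f g : α → ℕ} (hf : PolyBdd f) (hg : PolyBdd g) : PolyBdd fun a => f a + g a := by
  obtain ⟨P, hP⟩ := hf
  obtain ⟨Q, hQ⟩ := hg
  exact ⟨P + Q, fun a => by simpa using add_le_add (hP a) (hQ a)⟩

theorem mul {f g : α → ℕ} (hf : PolyBdd f) (hg : PolyBdd g) : PolyBdd fun a => f a * g a := by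
  obtain ⟨P, hP⟩ := hf
  obtain ⟨Q, hQ⟩ := hg
  exact ⟨P * Q, fun a => by simpa using Nat.mul_le_mul (hP a) (hQ a)⟩

/-- Polynomials over `ℕ` are monotone, so one bound serves all `b` below a given size. This
uniformity is needed for loops, where the intermediate values are not given by a fixed function of
the input. -/
theorem comp_le {g : β → ℕ} (hg : PolyBdd g) {s : α → ℕ} (hs : PolyBdd s) :
    ∃ h : α → ℕ, PolyBdd h ∧ ∀ a b, size b ≤ s a → g b ≤ h a := by
  obtain ⟨P, hP⟩ := hg
  obtain ⟨Q, hQ⟩ := hs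
  refine ⟨fun a => (P.comp Q).eval (size a), ⟨_, fun a => le_rfl⟩, fun a b hb => ?_⟩
  simp only [Polynomial.eval_comp]
  exact (hP b).trans (P.eval_nat_mono (hb.trans (hQ a)))

theorem comp {g : β → ℕ} (hg : PolyBdd g) {f : α → β} (hf : PolyBdd fun a => size (f a)) :
    PolyBdd fun a => g (f a) := by
  obtain ⟨h, hh, hle⟩ := hg.comp_le hf
  exact hh.of_le fun a => hle a _ le_rfl

end PolyBdd

end PolyBdd

/-! ### Polynomial-time functions: composition, pairing, case distinction -/

/-- `p` computes `f`, at the top of the data stack, within time `T`. -/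
def Computes {α β : Type} [TreeEnc α] [TreeEnc β] (p : TreeProg) (f : α → β) (T : α → ℕ) : Prop :=
  ∀ a r s, Exec p (stk [] (word a ++ r) s [] []) (stk [] (word (f a) ++ r) s [] []) (T a)

/-- `f` is computed in polynomial time by a program of the tree machine. -/
@[fun_prop]
def PolyFun {α β : Type} [TreeEnc α] [TreeEnc β] (f : α → β) : Prop :=
  PolyBdd (fun a => size (f a)) ∧ ∃ (p : TreeProg) (T : α → ℕ), PolyBdd T ∧ Computes p f T

namespace PolyFun

variable {α β γ δ : Type} [TreeEnc α] [TreeEnc β] [TreeEnc γ] [TreeEnc δ]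

theorem of_word_eq {f : α → β} (h : ∀ a, word (f a) = word a) : PolyFun f := by
  refine ⟨PolyBdd.sizeOf.of_le fun a => by simp [size, h], skip, _, .const 1, fun a r s => ?_⟩
  rw [h]
  exact exec_skip

@[fun_prop]
theorem id : PolyFun fun a : α => a := of_word_eq fun _ => rfl

@[fun_prop]
theorem comp {f : β → γ} {g : α → β} (hf : PolyFun f) (hg : PolyFun g) :
    PolyFun fun a => f (g a) := by
  obtain ⟨bf, p, T, hT, hp⟩ := hf
  obtain ⟨bg, q, U, hU, hq⟩ := hg
  exact ⟨bf.comp bg, .seq q p, _, hU.add (hT.comp bg), fun a r s => (hq a r s).seq (hp _ r s)⟩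

@[fun_prop]
theorem const (b : β) : PolyFun fun _ : α => b := by
  refine ⟨.const _, .seq drop (pushAll (word b)), _,
    ((PolyBdd.const 3).add ((PolyBdd.const 10).mul .sizeOf)).add (.const (size b + 1)),
    fun a r s => ?_⟩
  exact (exec_drop _).seq (exec_pushAll (word b))

@[fun_prop]
theorem pair {f : α → β} {g : α → γ} (hf : PolyFun f) (hg : PolyFun g) :
    PolyFun fun a => (f a, g a) := by
  obtain ⟨bf, p, T, hT, hp⟩ := hf
  obtain ⟨bg, q, U, hU, hq⟩ := hg
  refine ⟨((bf.add bg).add (.const 1)).of_le fun a => by simp,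
    -- One copy of the argument is consumed by `p`; its result is set aside while `q` consumes the
    -- other copy, and then comes back in front of it.
    .seq dup (.seq p (.seq save (.seq q (.seq restore (pushMain fun _ => true))))), _,
    ((PolyBdd.const 8).add ((PolyBdd.const 16).mul .sizeOf)).add (hT.add
      (((PolyBdd.const 4).add ((PolyBdd.const 10).mul bf)).add (hU.add
      ((((PolyBdd.const 3).mul bf).add (PolyBdd.const 2)).add (.const 1))))), fun a r s => ?_⟩
  refine (exec_dup _).seq ((hp a _ s).seq ((exec_save _).seq ((hq a r _).seq
    ((exec_restore_code _).seq ?_))))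
  rw [word_pair]
  change Exec _ (stk [] (word (f a) ++ _) _ _ _) _ _
  simpa using exec_pushMain (i := []) (m := word (f a) ++ (word (g a) ++ r)) (a := s) (b := [])
    (c := []) true

@[fun_prop]
theorem fst {f : α → β × γ} (hf : PolyFun f) : PolyFun fun a => (f a).1 := by
  refine comp (f := Prod.fst) ?_ hf
  refine ⟨PolyBdd.sizeOf.of_le fun ⟨a, b⟩ => by simp; omega,
    .seq popMain (.seq save (.seq drop restore)), _,
    ((PolyBdd.const 12).add ((PolyBdd.const 23).mul .sizeOf)), fun ⟨a, b⟩ r s => ?_⟩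
  rw [word_pair]
  have := (execTo_popMain (i := []) (m := word a ++ (word b ++ r)) (a := s) (b := []) (c := [])
    true).exec.seq ((exec_save (enc a)).seq ((exec_drop (enc b)).seq (exec_restore_code _)))
  refine Exec.mono (by simpa [word] using this) ?_
  have := size_pair a b
  unfold size word at *
  omega

@[fun_prop]
theorem snd {f : α → β × γ} (hf : PolyFun f) : PolyFun fun a => (f a).2 := by
  refine comp (f := Prod.snd) ?_ hf
  refine ⟨PolyBdd.sizeOf.of_le fun ⟨a, b⟩ => by simp; omega,
    .seq popMain drop, _,
    ((PolyBdd.const 4).add ((PolyBdd.const 10).mul .sizeOf)), fun ⟨a, b⟩ r s => ?_⟩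
  rw [word_pair]
  have := (execTo_popMain (i := []) (m := word a ++ (word b ++ r)) (a := s) (b := []) (c := [])
    true).exec.seq (exec_drop (enc a))
  refine Exec.mono (by simpa using this) ?_
  have := size_pair a b
  unfold size word at *
  omega

/-- Case distinction on a list. -/
theorem listCases {l : α → List β} {f : α → γ} {g : β → List β → α → γ} (hl : PolyFun l)
    (hf : PolyFun f) (hg : PolyFun fun x : (β × List β) × α => g x.1.1 x.1.2 x.2) :
    PolyFun fun a => match l a with | [] => f a | b :: l' => g b l' a := by
  obtain ⟨bf, p, T, hT, hp⟩ := hf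
  obtain ⟨bg, q, U, hU, hq⟩ := hg
  have h : PolyFun fun x : List β × α => match x.1 with | [] => f x.2 | b :: l' => g b l' x.2 := by
    have hsnd : PolyBdd fun x : List β × α => size x.2 :=
      PolyBdd.sizeOf.of_le fun x => by
        obtain ⟨a, b⟩ := x
        simp
        omega
    obtain ⟨sf, hsf, bsf⟩ := bf.comp_le hsnd
    obtain ⟨sg, hsg, bsg⟩ := bg.comp_le (PolyBdd.sizeOf (α := List β × α))
    obtain ⟨tf, htf, btf⟩ := hT.comp_le hsnd
    obtain ⟨tg, htg, btg⟩ := hU.comp_le (PolyBdd.sizeOf (α := List β × α))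
    have key : ∀ (b : β) (l' : List β) (a : α), size ((b, l'), a) ≤ size (b :: l', a) := by
      intro b l' a
      simp
    -- The first pop removes the mark of the pair, the second tells whether the list is empty. If it
    -- is not, the words of `b`, `l'` and `a` lie on the stack, and two node marks make them the
    -- code of `((b, l'), a)`.
    refine ⟨(hsf.add hsg).of_le ?_, .seq popMain (.seq popMain (.ite Reg.bit
      (.seq (pushMain fun _ => true) (.seq (pushMain fun _ => true) q)) p)), _,
      (PolyBdd.const 5).add (htf.add htg), ?_⟩
    · rintro ⟨l, a⟩
      cases l with
      | nil => exact (bsf ([], a) a le_rfl).trans (Nat.le_add_right _ _)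
      | cons b l' => exact (bsg (b :: l', a) _ (key b l' a)).trans (Nat.le_add_left _ _)
    · rintro ⟨l, a⟩ r s
      rw [word_pair]
      refine Exec.mono ((execTo_popMain true).exec.seq ?_ (T' := 4 + (tf (l, a) + tg (l, a))))
        (by change _ ≤ 5 + (tf (l, a) + tg (l, a)); omega)
      cases l with
      | nil =>
        refine Exec.mono (ExecTo.seq_iteFalse (execTo_popMain (m := word a ++ r) false) rfl
          (hp a r s)) ?_
        have := btf ([], a) a le_rfl
        omega
      | cons b l' =>
        refine Exec.mono (ExecTo.seq_iteTrue (execTo_popMain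
          (m := word b ++ word l' ++ word a ++ r) true) rfl
          ((exec_pushMain true).seq ((exec_pushMain true).seq (?_ : Exec _ _ _
            (U ((b, l'), a)))))) ?_
        · simpa [word_pair] using hq ((b, l'), a) r s
        · have := btg (b :: l', a) _ (key b l' a)
          omega
  exact comp h (pair hl id)

@[fun_prop]
theorem ite {c : α → Bool} {f g : α → γ} (hc : PolyFun c) (hf : PolyFun f) (hg : PolyFun g) :
    PolyFun fun a => if c a then f a else g a := by
  -- A bit has the same code as a list of units of length 0 or 1, so this is a case distinction on a
  -- list.
  have h₁ : PolyFun fun b : Bool => if b then [()] else [] :=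
    of_word_eq fun b => by cases b <;> rfl
  have h₂ : PolyFun fun x : (Unit × List Unit) × α => f x.2 := hf.comp (snd id)
  have := listCases (g := fun _ _ a => f a) (comp h₁ hc) hg h₂
  convert this using 2 with a
  cases c a <;> rfl

end PolyFun

/-! ### Folds and list operations -/

namespace PolyFun

variable {α β γ δ : Type} [TreeEnc α] [TreeEnc β] [TreeEnc γ] [TreeEnc δ]

/-- One pass of a loop over a list: apply `p` to the head and the accumulator. -/
def foldBody (p : TreeProg) : TreeProg :=
  .seq (scan false true) (.seq save (.seq drain (.seq (pushMain fun _ => true) (.seq p restore))))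

/-- The accumulator lies below the rest of the list. The head waits on the scratch stack while the
rest is saved, and is then paired with the accumulator. -/
theorem exec_foldBody {g : β × δ → δ} {p : TreeProg} {T : β × δ → ℕ} (hp : Computes p g T)
    (b : β) (l : List β) (d : δ) (r : List Bool) (s : List (Option Bool)) :
    Exec (foldBody p) (stk [] (word b ++ (word l ++ (word d ++ r))) s [] [])
      (stk [] (word l ++ (word (g (b, d)) ++ r)) s [] [])
      (12 + 13 * size b + 13 * size l + T (b, d)) := by
  have h₁ := exec_scan (i := []) (m := word l ++ (word d ++ r)) (a := s) (b := []) false true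
    (enc b)
  have h₂ := exec_save (i := []) (m := word d ++ r) (a := s) (b := (word b).reverse) (enc l)
  have h₃ := exec_drain (i := []) (a := (word l).reverse.map some ++ none :: s) (c := [])
    (word b).reverse (m := word d ++ r)
  have h₄ := exec_pushMain (i := []) (m := word b ++ (word d ++ r))
    (a := (word l).reverse.map some ++ none :: s) (b := []) (c := []) true
  have h₅ := hp (b, d) r ((word l).reverse.map some ++ none :: s)
  have h₆ := exec_restore_code (i := []) (m := word (g (b, d)) ++ r) (a := s) (b := []) (c := [])
    (enc l)
  simp only [Bool.false_eq_true, if_false, if_true, List.append_nil, List.reverse_reverse,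
    List.length_reverse, word_pair, List.cons_append, List.append_assoc] at h₁ h₂ h₃ h₄ h₅ h₆
  refine (h₁.seq (h₂.seq (h₃.seq (h₄.seq (h₅.seq h₆))))).mono ?_
  simp only [size, word]
  omega

theorem exec_fold {g : β × δ → δ} {p : TreeProg} {T : β × δ → ℕ} (hp : Computes p g T) {B : ℕ}
    (r : List Bool) (s : List (Option Bool)) (l : List β) : ∀ d : δ,
    (∀ l₁ b l₂, l = l₁ ++ b :: l₂ → T (b, l₁.foldl (fun d b => g (b, d)) d) ≤ B) →
    Exec (whileDo popMain Reg.bit (foldBody p)) (stk [] (word l ++ (word d ++ r)) s [] [])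
      (stk [] (word (l.foldl (fun d b => g (b, d)) d) ++ r) s [] [])
      (l.length * (14 + 13 * size l + B) + 2) := by
  induction l with
  | nil =>
    intro d _
    exact ((execTo_popMain false).whileDo_done rfl).mono (by simp)
  | cons b l ih =>
    intro d hB
    have h := ih (g (b, d)) fun l₁ c l₂ hl => hB (b :: l₁) c l₂ (by simp [hl])
    have hb := hB [] b l rfl
    have h₀ := exec_foldBody hp b l d r s (Reg.ofBool true)
    have := ExecTo.whileDo_step (b := Reg.bit)
      (execTo_popMain (i := []) (m := word b ++ (word l ++ (word d ++ r))) (a := s) (b := [])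
        (c := []) true) rfl h₀ h
    simp only [word_cons, List.cons_append, List.append_assoc]
    refine this.mono ?_
    have h₂ : l.length * (14 + 13 * size l + B) ≤ l.length * (14 + 13 * size (b :: l) + B) := by
      gcongr
      simp
      omega
    simp only [List.foldl_nil] at hb
    simp only [List.length_cons, add_mul l.length, one_mul, size_cons] at h₂ ⊢
    omega

/-- Iterating a polynomial-time step can enlarge the accumulator exponentially. The bound `A` on the
accumulators at all prefixes excludes this and bounds the time of every single pass. -/
theorem foldl_aux {g : β × δ → δ} (hg : PolyFun g) {inp : α → List β × δ} (hin : PolyFun inp)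
    {A : α → ℕ} (hA : PolyBdd A)
    (hb : ∀ a l, l <+: (inp a).1 → size (l.foldl (fun d b => g (b, d)) (inp a).2) ≤ A a) :
    PolyFun fun a => (inp a).1.foldl (fun d b => g (b, d)) (inp a).2 := by
  obtain ⟨-, p, T, hT, hp⟩ := hg
  obtain ⟨bq, q, U, hU, hq⟩ := hin
  obtain ⟨B, hB, hTB⟩ := hT.comp_le (bq.add (hA.add (.const 1)))
  refine ⟨hA.of_le fun a => hb a _ List.prefix_rfl,
    .seq q (.seq popMain (whileDo popMain Reg.bit (foldBody p))), _,
    hU.add ((PolyBdd.const 3).add (bq.mul (((PolyBdd.const 14).add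
      ((PolyBdd.const 13).mul bq)).add hB))), fun a r s => ?_⟩
  have h := exec_fold hp (B := B a) r s (inp a).1 (inp a).2 fun l₁ b l₂ hl => by
    refine hTB _ _ ?_
    have h₁ := hb a l₁ ⟨_, hl.symm⟩
    have h₂ : size b + 2 ≤ size (inp a).1 := size_le_of_mem (by simp [hl])
    have h₃ := size_pair (inp a).1 (inp a).2
    simp only [Prod.mk.eta] at h₃
    simp only [size_pair]
    omega
  have h₂ := hq a r s
  rw [← Prod.mk.eta (p := inp a), word_pair] at h₂
  refine Exec.mono (h₂.seq ((execTo_popMain true).exec.seq (?_ : Exec _ _ _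
    ((inp a).1.length * (14 + 13 * size (inp a).1 + B a) + 2)))) (Nat.add_le_add_left ?_ _)
  · simpa using h
  · have h₃ := size_pair (inp a).1 (inp a).2
    have h₄ := length_lt_size (inp a).1
    have : (inp a).1.length * (14 + 13 * size (inp a).1 + B a) ≤
        size (inp a) * (14 + 13 * size (inp a) + B a) := by
      simp only [Prod.mk.eta] at h₃
      gcongr <;> omega
    omega

/-- Folds over a list are in polynomial time when the accumulators are polynomially bounded. -/
theorem foldl {l : α → List β} {z : α → γ} {step : α → γ → β → γ} (hl : PolyFun l)
    (hz : PolyFun z) (hs : PolyFun fun x : (α × γ) × β => step x.1.1 x.1.2 x.2) {A : α → ℕ}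
    (hA : PolyBdd A) (hb : ∀ a l', l' <+: l a → size (l'.foldl (step a) (z a)) ≤ A a) :
    PolyFun fun a => (l a).foldl (step a) (z a) := by
  have key : ∀ a (l' : List β) c, l'.foldl (fun (d : α × γ) b => (d.1, step d.1 d.2 b)) (a, c) =
      (a, l'.foldl (step a) c) := by
    intro a l'
    induction l' with
    | nil => intro c; rfl
    | cons b l' ih => intro c; exact ih _
  have h := foldl_aux (g := fun x : β × (α × γ) => (x.2.1, step x.2.1 x.2.2 x.1))
    (inp := fun a => (l a, (a, z a))) (A := fun a => size a + A a + 1)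
    (pair (fst (snd id)) (comp hs (pair (snd id) (fst id))))
    (pair hl (pair id hz)) ((PolyBdd.sizeOf.add hA).add (.const 1)) (fun a l' hl' => by
      have := hb a l' hl'
      simp only [key, size_pair]
      omega)
  simp only [key] at h
  exact snd h

/-- Folds in which a measure of the accumulators grows by a bounded amount in every step. -/
theorem foldl_of_measure {l : α → List β} {z : α → γ} {step : α → γ → β → γ} (hl : PolyFun l)
    (hz : PolyFun z) (hs : PolyFun fun x : (α × γ) × β => step x.1.1 x.1.2 x.2) (μ : γ → ℕ)
    (hμ : ∀ c, μ c ≤ size c ∧ size c ≤ 4 * μ c + 1) {G : α × β → ℕ} (hG : PolyBdd G)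
    (hb : ∀ a c b, μ (step a c b) ≤ μ c + G (a, b)) :
    PolyFun fun a => (l a).foldl (step a) (z a) := by
  obtain ⟨H, hH, hGH⟩ := hG.comp_le ((PolyBdd.sizeOf (α := α)).add (hl.1.add (.const 1)))
  refine foldl hl hz hs (((PolyBdd.const 4).mul (hz.1.add (hl.1.mul hH))).add (.const 1))
    fun a l' hl' => ?_
  -- The increments are added up in `μ`; the factor between `μ` and the code size is paid only once,
  -- at the end.
  have key : ∀ (l' : List β) c, (∀ b ∈ l', b ∈ l a) →
      μ (l'.foldl (step a) c) ≤ μ c + l'.length * H a := by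
    intro l'
    induction l' with
    | nil => intro c _; simp
    | cons b l' ih =>
      intro c hc
      have h₁ := ih (step a c b) fun b' hb' => hc b' (by simp [hb'])
      have h₂ := hb a c b
      have h₃ := size_le_of_mem (hc b (by simp))
      have h₄ := hGH a (a, b) (by simp only [size_pair]; omega)
      simp only [List.foldl_cons, List.length_cons, add_mul]
      omega
  have h₁ := key l' (z a) fun b hb => hl'.subset hb
  have h₂ := (hμ (l'.foldl (step a) (z a))).2
  have h₃ := (hμ (z a)).1
  have h₄ : l'.length * H a ≤ size (l a) * H a := by
    have := hl'.length_le
    have := length_lt_size (l a)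
    gcongr
    omega
  omega

/-- Folds whose accumulators grow by a bounded amount in every step. -/
theorem foldl_of_growth {l : α → List β} {z : α → γ} {step : α → γ → β → γ} (hl : PolyFun l)
    (hz : PolyFun z) (hs : PolyFun fun x : (α × γ) × β => step x.1.1 x.1.2 x.2)
    {G : α × β → ℕ} (hG : PolyBdd G)
    (hb : ∀ a c b, size (step a c b) ≤ size c + G (a, b)) :
    PolyFun fun a => (l a).foldl (step a) (z a) :=
  foldl_of_measure hl hz hs size (fun c => ⟨le_rfl, by omega⟩) hG hb

@[fun_prop]
theorem cons {f : α → β} {l : α → List β} (hf : PolyFun f) (hl : PolyFun l) :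
    PolyFun fun a => f a :: l a :=
  comp (f := fun p : β × List β => p.1 :: p.2) (of_word_eq fun _ => rfl) (pair hf hl)

@[fun_prop]
theorem reverse {l : α → List β} (hl : PolyFun l) : PolyFun fun a => (l a).reverse := by
  have h := foldl_of_growth (step := fun _ (c : List β) b => b :: c) hl
    (const ([] : List β)) (by fun_prop) (G := fun x => size x) .sizeOf
    (fun a c b => by simp only [size_cons, size_pair]; omega)
  simpa using h

@[fun_prop]
theorem append {l l' : α → List β} (hl : PolyFun l) (hl' : PolyFun l') :
    PolyFun fun a => l a ++ l' a := by
  have h := foldl_of_growth (step := fun _ (c : List β) b => b :: c) (reverse hl)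
    hl' (by fun_prop) (G := fun x => size x) .sizeOf
    (fun a c b => by simp only [size_cons, size_pair]; omega)
  simpa using h

@[fun_prop]
theorem map {l : α → List β} {f : α → β → γ} (hl : PolyFun l)
    (hf : PolyFun fun x : α × β => f x.1 x.2) : PolyFun fun a => (l a).map (f a) := by
  have h := foldl_of_growth (step := fun a (c : List γ) b => f a b :: c) (reverse hl)
    (const ([] : List γ)) (by fun_prop) (hf.1.add (.const 1))
    (fun a c b => by simp only [size_cons]; omega)
  simpa only [List.foldl_reverse, List.foldr_cons_eq_append, List.append_nil] using h

@[fun_prop]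
theorem flatten {l : α → List (List β)} (hl : PolyFun l) : PolyFun fun a => (l a).flatten := by
  have h := foldl_of_growth (step := fun _ (c : List β) b => b ++ c) (reverse hl)
    (const ([] : List β)) (by fun_prop) (G := fun x => size x) .sizeOf
    (fun a c b => by have := size_append b c; simp only [size_pair]; omega)
  convert h using 2 with a
  induction l a with
  | nil => rfl
  | cons b l ih => simp [List.foldl_append, ih]

@[fun_prop]
theorem flatMap {l : α → List β} {f : α → β → List γ} (hl : PolyFun l)
    (hf : PolyFun fun x : α × β => f x.1 x.2) : PolyFun fun a => (l a).flatMap (f a) := by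
  simpa only [List.flatMap_def] using flatten (map hl hf)

@[fun_prop]
theorem filter {l : α → List β} {f : α → β → Bool} (hl : PolyFun l)
    (hf : PolyFun fun x : α × β => f x.1 x.2) : PolyFun fun a => (l a).filter (f a) := by
  have h := flatMap (f := fun a b => if f a b then [b] else []) hl (by fun_prop)
  convert h using 2 with a
  induction l a with
  | nil => rfl
  | cons b l ih => by_cases hb : f a b <;> simp [hb, ih]

@[fun_prop]
theorem not {f : α → Bool} (hf : PolyFun f) : PolyFun fun a => !f a := by
  have := ite hf (const false) (const true)
  convert this using 2 with a
  cases f a <;> rfl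

@[fun_prop]
theorem and {f g : α → Bool} (hf : PolyFun f) (hg : PolyFun g) : PolyFun fun a => f a && g a := by
  have := ite hf hg (const false)
  convert this using 2 with a
  cases f a <;> rfl

@[fun_prop]
theorem or {f g : α → Bool} (hf : PolyFun f) (hg : PolyFun g) : PolyFun fun a => f a || g a := by
  have := ite hf (const true) hg
  convert this using 2 with a
  cases f a <;> rfl

@[fun_prop]
theorem decideEqTrue {c : α → Bool} (hc : PolyFun c) : PolyFun fun a => decide (c a = true) := by
  simpa using hc

@[fun_prop]
theorem iteProp {p : α → Prop} [∀ a, Decidable (p a)] {f g : α → γ}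
    (hp : PolyFun fun a => decide (p a)) (hf : PolyFun f) (hg : PolyFun g) :
    PolyFun fun a => if p a then f a else g a := by
  simpa using ite hp hf hg

@[fun_prop]
theorem any {l : α → List β} {f : α → β → Bool} (hl : PolyFun l)
    (hf : PolyFun fun x : α × β => f x.1 x.2) : PolyFun fun a => (l a).any (f a) := by
  have h := foldl_of_growth (step := fun a (c : Bool) b => f a b || c) (reverse hl)
    (const false) (by fun_prop) (.const 3)
    (fun a c b => (size_bool_le _).trans (Nat.le_add_left _ _))
  convert h using 2 with a
  induction l a with
  | nil => rfl
  | cons b l ih => simp [List.foldl_append, ih]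

@[fun_prop]
theorem beqBool {f g : α → Bool} (hf : PolyFun f) (hg : PolyFun g) :
    PolyFun fun a => f a == g a := by
  have := ite hf hg (not hg)
  convert this using 2 with a
  cases f a <;> cases g a <;> rfl

@[fun_prop]
theorem isEmpty {l : α → List β} (hl : PolyFun l) : PolyFun fun a => (l a).isEmpty := by
  have h := listCases (g := fun _ _ _ => false) hl (const true) (const false)
  convert h using 2 with a
  cases l a <;> rfl

theorem getDConst (d : β) (n : ℕ) : ∀ {α : Type} [TreeEnc α] {l : α → List β}, PolyFun l →
    PolyFun fun a => (l a).getD n d := by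
  induction n with
  | zero =>
    intro α _ l hl
    have h := listCases (g := fun b _ _ => b) hl (const d) (by fun_prop)
    convert h using 2 with a
    cases l a <;> rfl
  | succ n ih =>
    intro α _ l hl
    have h := listCases (g := fun _ l' _ => l'.getD n d) hl (const d) (ih (by fun_prop))
    convert h using 2 with a
    cases l a <;> simp

end PolyFun

/-! ### Arithmetic on binary numbers -/

namespace TreeEnc

theorem size_nat (n : ℕ) : Nat.size n ≤ size n ∧ size n ≤ 4 * Nat.size n + 1 := by
  have : ∀ l : List Bool, l.length ≤ size l ∧ size l ≤ 4 * l.length + 1 := by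
    intro l
    induction l with
    | nil => simp
    | cons b l ih =>
      have := size_bool_le b
      simp only [List.length_cons, size_cons]
      omega
  rw [← Nat.size_eq_bits_len]
  exact this n.bits

theorem size_bit_le (b : Bool) (n : ℕ) : size (Nat.bit b n) ≤ size n + 4 := by
  by_cases h : n = 0 → b = true
  · have : size (Nat.bit b n) = size (b :: n.bits) :=
      congrArg (fun l : List Bool => size l) (Nat.bits_append_bit n b h)
    have h₂ := size_bool_le b
    have h₃ : size n.bits = size n := rfl
    simp only [size_cons] at this
    omega
  · simp only [Classical.not_imp, Bool.not_eq_true] at h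
    simp [h.1, h.2]

theorem size_div2_le (n : ℕ) : size n.div2 ≤ size n := by
  have : size n.div2 = size n.bits.tail :=
    congrArg (fun l : List Bool => size l) (Nat.div2_bits_eq_tail n)
  rw [this]
  exact size_le_of_sublist (List.tail_sublist _)

end TreeEnc

theorem Nat.size_add_le (m n : ℕ) : Nat.size (m + n) ≤ Nat.size m + Nat.size n + 1 := by
  rw [Nat.size_le]
  have h₁ : m < 2 ^ m.size := Nat.lt_size_self m
  have h₂ : n < 2 ^ n.size := Nat.lt_size_self n
  have h₃ : 2 ^ m.size ≤ 2 ^ (m.size + n.size) := Nat.pow_le_pow_right (by norm_num) (by omega)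
  have h₄ : 2 ^ n.size ≤ 2 ^ (m.size + n.size) := Nat.pow_le_pow_right (by norm_num) (by omega)
  rw [pow_succ]
  omega

theorem Nat.size_mul_le (m n : ℕ) : Nat.size (m * n) ≤ Nat.size m + Nat.size n := by
  rw [Nat.size_le, pow_add]
  exact Nat.mul_lt_mul'' (Nat.lt_size_self m) (Nat.lt_size_self n)

namespace PolyFun

variable {α β γ δ : Type} [TreeEnc α] [TreeEnc β] [TreeEnc γ] [TreeEnc δ]

@[fun_prop]
theorem natBits {f : α → ℕ} (hf : PolyFun f) : PolyFun fun a => (f a).bits := hf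

theorem of_natBits {f : α → ℕ} (hf : PolyFun fun a => (f a).bits) : PolyFun f := hf

@[fun_prop]
theorem natBit {b : α → Bool} {n : α → ℕ} (hb : PolyFun b) (hn : PolyFun n) :
    PolyFun fun a => Nat.bit (b a) (n a) := by
  refine of_natBits ?_
  -- Zero has the empty list of bits, so a bit `false` in front of zero must not be stored.
  have := ite (ite hb (const false) (isEmpty (natBits hn))) (const ([] : List Bool))
    (cons hb (natBits hn))
  convert this using 2 with a
  by_cases h : n a = 0 → b a = true
  · rw [Nat.bits_append_bit _ _ h]
    cases hb : b a
    · have : (n a).bits ≠ [] := by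
        intro h0
        have : Nat.size (n a) = 0 := by rw [← Nat.size_eq_bits_len, h0]; rfl
        simp_all [Nat.size_eq_zero]
      simp [this]
    · simp
  · simp only [Classical.not_imp, Bool.not_eq_true] at h
    simp [h.1, h.2]

@[fun_prop]
theorem natDiv2 {n : α → ℕ} (hn : PolyFun n) : PolyFun fun a => (n a).div2 := by
  refine of_natBits ?_
  have := listCases (g := fun _ l _ => l) (natBits hn) (const ([] : List Bool)) (by fun_prop)
  convert this using 2 with a
  rw [Nat.div2_bits_eq_tail]
  cases (n a).bits <;> rfl

@[fun_prop]
theorem natBodd {n : α → ℕ} (hn : PolyFun n) : PolyFun fun a => (n a).bodd := by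
  have := getDConst false 0 (natBits hn)
  convert this using 2 with a
  rw [Nat.bodd_eq_bits_head]
  cases (n a).bits <;> rfl

/-- One step of the addition of two numbers with carry. -/
def addStep (s : (ℕ × ℕ) × Bool × List Bool) : (ℕ × ℕ) × Bool × List Bool :=
  ((s.1.1.div2, s.1.2.div2),
    if s.1.1.bodd then s.1.2.bodd || s.2.1 else s.1.2.bodd && s.2.1,
    (s.1.1.bodd == (s.1.2.bodd == s.2.1)) :: s.2.2)

/-- The output bits pile up with the most significant one on top, so folding with `Nat.bit` reads
the number off. The bound on the sum says that enough rounds remain to consume all bits and the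
carry. -/
theorem foldl_addStep {ε : Type} (l : List ε) : ∀ (a b : ℕ) (c : Bool) (o : List Bool),
    a + b + c.toNat < 2 ^ l.length →
    ((l.foldl (fun s _ => addStep s) ((a, b), c, o)).2.2).foldl (fun n b => Nat.bit b n) 0 =
      o.foldl (fun n b => Nat.bit b n) (a + b + c.toNat) := by
  induction l with
  | nil =>
    intro a b c o h
    simp only [List.length_nil, pow_zero, Nat.lt_one_iff] at h
    rw [h]
    rfl
  | cons x l ih =>
    intro a b c o h
    simp only [List.length_cons, pow_succ] at h
    have ha := Nat.bodd_add_div2 a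
    have hb := Nat.bodd_add_div2 b
    have hs : addStep ((a, b), c, o) = ((a.div2, b.div2),
      if a.bodd then b.bodd || c else b.bodd && c, (a.bodd == (b.bodd == c)) :: o) := rfl
    rw [List.foldl_cons, hs, ih]
    · rw [List.foldl_cons]
      congr 1
      -- Two nested equality tests of three bits give their sum modulo 2.
      cases h₁ : a.bodd <;> cases h₂ : b.bodd <;> cases c <;>
        simp only [h₁, h₂, Bool.toNat_false, Bool.toNat_true] at ha hb ⊢ <;>
        simp [Nat.bit] <;> omega
    · cases h₁ : a.bodd <;> cases h₂ : b.bodd <;> cases c <;>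
        simp only [h₁, h₂, Bool.toNat_false, Bool.toNat_true] at ha hb h ⊢ <;>
        simp <;> omega

@[fun_prop]
theorem natAdd {m n : α → ℕ} (hm : PolyFun m) (hn : PolyFun n) :
    PolyFun fun a => m a + n a := by
  -- The list serves only as a clock; the extra entry makes room for the carry.
  have h₁ : PolyFun fun a => ((m a).bits ++ (n a).bits ++ [true]).foldl
      (fun s _ => addStep s) ((m a, n a), false, []) := by
    refine foldl_of_growth (step := fun _ s _ => addStep s) (by fun_prop) (by fun_prop)
      (by unfold addStep; fun_prop) (.const 20) fun a c b => ?_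
    obtain ⟨⟨x, y⟩, c, o⟩ := c
    have h₁ := size_div2_le x
    have h₂ := size_div2_le y
    have h₃ := size_bool_le (if x.bodd then y.bodd || c else y.bodd && c)
    have h₄ := size_bool_le (x.bodd == (y.bodd == c))
    simp only [addStep, size_pair, size_cons]
    omega
  have h₂ := foldl_of_growth (step := fun _ (n : ℕ) b => Nat.bit b n) (snd (snd h₁)) (const 0)
    (by fun_prop) (.const 4) (fun _ n b => size_bit_le b n)
  convert h₂ using 2 with a
  rw [foldl_addStep]
  · simp
  · have := Nat.size_add_le (m a) (n a)
    rw [Nat.size_le] at this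
    simpa [Nat.size_eq_bits_len, add_assoc] using this

/-- One step of the comparison of two numbers. -/
def leStep (s : (ℕ × ℕ) × Bool) : (ℕ × ℕ) × Bool :=
  ((s.1.1.div2, s.1.2.div2), if s.1.1.bodd == s.1.2.bodd then s.2 else s.1.2.bodd)

/-- Bits come with increasing significance, so a later difference overrides the verdict `c` on the
lower bits. -/
theorem foldl_leStep {ε : Type} (l : List ε) : ∀ (a b : ℕ) (c : Bool),
    a < 2 ^ l.length → b < 2 ^ l.length →
    ((l.foldl (fun s _ => leStep s) ((a, b), c)).2 = true ↔ a < b ∨ a = b ∧ c = true) := by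
  induction l with
  | nil =>
    intro a b c ha hb
    simp only [List.length_nil, pow_zero, Nat.lt_one_iff] at ha hb
    simp [ha, hb]
  | cons x l ih =>
    intro a b c h h'
    simp only [List.length_cons, pow_succ] at h h'
    have ha := Nat.bodd_add_div2 a
    have hb := Nat.bodd_add_div2 b
    have hs : leStep ((a, b), c) = ((a.div2, b.div2),
      if a.bodd == b.bodd then c else b.bodd) := rfl
    rw [List.foldl_cons, hs, ih _ _ _ (by rw [Nat.div2_val]; omega) (by rw [Nat.div2_val]; omega)]
    cases h₁ : a.bodd <;> cases h₂ : b.bodd <;> cases c <;>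
      simp only [h₁, h₂, Bool.toNat_false, Bool.toNat_true] at ha hb ⊢ <;>
      simp <;> omega

@[fun_prop]
theorem natLe {m n : α → ℕ} (hm : PolyFun m) (hn : PolyFun n) :
    PolyFun fun a => decide (m a ≤ n a) := by
  have h₁ : PolyFun fun a => ((m a).bits ++ (n a).bits).foldl
      (fun s _ => leStep s) ((m a, n a), true) := by
    refine foldl_of_growth (step := fun _ s _ => leStep s) (by fun_prop) (by fun_prop)
      (by unfold leStep; fun_prop) (.const 20) fun a c b => ?_
    obtain ⟨⟨x, y⟩, c⟩ := c
    have h₁ := size_div2_le x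
    have h₂ := size_div2_le y
    have h₃ := size_bool_le (if x.bodd == y.bodd then c else y.bodd)
    simp only [leStep, size_pair]
    omega
  have h₂ := snd h₁
  convert h₂ using 2 with a
  rw [Bool.eq_iff_iff, foldl_leStep]
  · simp [le_iff_lt_or_eq]
  · exact (Nat.lt_size_self _).trans_le (Nat.pow_le_pow_right (by norm_num)
      (by simp [Nat.size_eq_bits_len]))
  · exact (Nat.lt_size_self _).trans_le (Nat.pow_le_pow_right (by norm_num)
      (by simp [Nat.size_eq_bits_len]))

@[fun_prop]
theorem natLt {m n : α → ℕ} (hm : PolyFun m) (hn : PolyFun n) :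
    PolyFun fun a => decide (m a < n a) := by
  have := not (natLe hn hm)
  convert this using 2 with a
  rw [Bool.eq_iff_iff]
  simp

@[fun_prop]
theorem natEq {m n : α → ℕ} (hm : PolyFun m) (hn : PolyFun n) :
    PolyFun fun a => decide (m a = n a) := by
  have := and (natLe hm hn) (natLe hn hm)
  convert this using 2 with a
  rw [Bool.eq_iff_iff]
  simp [le_antisymm_iff]

@[fun_prop]
theorem natMul {m n : α → ℕ} (hm : PolyFun m) (hn : PolyFun n) :
    PolyFun fun a => m a * n a := by
  -- Horner's scheme from the most significant bit. A doubling and an addition lengthen the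
  -- accumulator by at most a fixed number of bits for given `a`.
  have h := foldl_of_measure
    (step := fun a (c : ℕ) b => Nat.bit false c + if b then n a else 0) (reverse (natBits hm))
    (const 0) (by fun_prop) Nat.size size_nat
    (hn.1.comp (fst (γ := Bool) id).1 |>.add (.const 2)) (fun a c b => by
      have h₁ := Nat.size_add_le (Nat.bit false c) (if b then n a else 0)
      have h₂ : Nat.size (Nat.bit false c) ≤ c.size + 1 := by
        by_cases hc : c = 0
        · simp [hc]
        · rw [Nat.size_bit (by simp [hc])]
      have h₃ : Nat.size (if b then n a else 0) ≤ size (n a) := by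
        cases b
        · simp
        · exact (size_nat _).1
      change _ ≤ c.size + (size (n a) + 2)
      omega)
  convert h using 2 with a
  rw [List.foldl_reverse]
  generalize m a = x
  induction x using Nat.binaryRec' with
  | zero => simp
  | bit b x hx ih =>
    rw [Nat.bits_append_bit _ _ hx, List.foldr_cons, ← ih]
    cases b <;> simp [Nat.bit] <;> ring

@[fun_prop]
theorem listSum {l : α → List ℕ} (hl : PolyFun l) : PolyFun fun a => (l a).sum := by
  have h := foldl_of_measure (step := fun _ (c : ℕ) b => b + c) (reverse hl) (const 0)
    (by fun_prop) Nat.size size_nat ((snd (β := α) id).1.add (.const 1)) (fun a c b => by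
      have h₁ := Nat.size_add_le b c
      have h₂ := (size_nat b).1
      change _ ≤ c.size + (size b + 1)
      omega)
  convert h using 2 with a
  rw [List.foldl_reverse, List.sum_eq_foldr]

@[fun_prop]
theorem listProd {l : α → List ℕ} (hl : PolyFun l) : PolyFun fun a => (l a).prod := by
  have h := foldl_of_measure (step := fun _ (c : ℕ) b => b * c) (reverse hl) (const 1)
    (by fun_prop) Nat.size size_nat ((snd (β := α) id).1.add (.const 1)) (fun a c b => by
      have h₁ := Nat.size_mul_le b c
      have h₂ := (size_nat b).1
      change _ ≤ c.size + (size b + 1)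
      omega)
  convert h using 2 with a
  rw [List.foldl_reverse, List.prod_eq_foldr]

@[fun_prop]
theorem length {l : α → List β} (hl : PolyFun l) : PolyFun fun a => (l a).length := by
  have h := listSum (map (f := fun _ _ => 1) hl (const 1))
  simpa using h

@[fun_prop]
theorem range_length {l : α → List β} (hl : PolyFun l) :
    PolyFun fun a => List.range (l a).length := by
  have key : ∀ l : List β, l.foldl (fun (c : List ℕ) _ => c.length :: c) [] =
      (List.range l.length).reverse := by
    intro l
    induction l using List.reverseRecOn with
    | nil => rfl
    | append_singleton l b ih => simp [List.foldl_append, ih, List.range_succ]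
  -- The entry added in a step depends on the accumulator, so the accumulators are bounded by their
  -- explicit form `key`.
  have h := foldl (step := fun _ (c : List ℕ) _ => c.length :: c) hl (const []) (by fun_prop)
    (A := fun a => size (l a) * (4 * size (l a) + 2) + 1)
    ((hl.1.mul (((PolyBdd.const 4).mul hl.1).add (.const 2))).add (.const 1)) (fun a l' hl' => by
      have h₁ := hl'.length_le
      have h₂ := length_lt_size (l a)
      rw [key, size_reverse]
      refine (size_le_of_forall (B := 4 * size (l a) + 1) fun n hn => ?_).trans ?_
      · rw [List.mem_range] at hn
        have := (size_nat n).2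
        have : Nat.size n ≤ n := Nat.size_le.2 Nat.lt_two_pow_self
        omega
      · rw [List.length_range]
        gcongr
        omega)
  have h₂ := reverse h
  simpa [key] using h₂

@[fun_prop]
theorem getD {l : α → List β} {i : α → ℕ} (hl : PolyFun l) (hi : PolyFun i) (d : β) :
    PolyFun fun a => (l a).getD (i a) d := by
  -- The list of units counts the positions passed so far.
  have h := foldl_of_growth
    (step := fun a (c : List Unit × β) b => (() :: c.1, if decide (c.1.length = i a) then b else c.2))
    hl (const ([], d)) (by fun_prop) (G := fun x => size x + 2) (PolyBdd.sizeOf.add (.const 2))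
    (fun a c b => by
      obtain ⟨u, c⟩ := c
      have h : size () = 1 := rfl
      simp only [size_pair, size_cons, h]
      split <;> omega)
  convert snd h using 2 with a
  have key : ∀ (l : List β) (u : List Unit) (c : β),
      (l.foldl (fun (c : List Unit × β) b => (() :: c.1, if decide (c.1.length = i a) then b else c.2))
        (u, c)).2 = if u.length ≤ i a then l.getD (i a - u.length) c else c := by
    intro l
    induction l with
    | nil => intro u c; simp
    | cons b l ih =>
      intro u c
      rw [List.foldl_cons, ih]
      rcases lt_trichotomy u.length (i a) with h | h | h
      · obtain ⟨k, hk⟩ : ∃ k, i a - u.length = k + 1 := ⟨i a - u.length - 1, by omega⟩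
        have hk' : i a - (u.length + 1) = k := by omega
        simp [h.le, h.ne, Nat.succ_le_of_lt h, hk, hk']
      · simp [h]
      · have h₁ : ¬ u.length ≤ i a := by omega
        have h₂ : ¬ u.length + 1 ≤ i a := by omega
        have h₃ : ¬ u.length = i a := by omega
        simp [h₁, h₂, h₃]
  rw [key]
  simp

end PolyFun

/-! ### Functions on finite types and input symbols -/

section Finite

namespace TreeEnc

noncomputable instance {ι α : Type} [Fintype ι] [TreeEnc α] : TreeEnc (ι → α) :=
  ⟨fun f => enc ((Finset.univ : Finset ι).toList.map f)⟩

/-- The position of an input symbol in a list of all of them. -/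
def symbolIndex : ApprovalVoting.InputSymbol → ℕ
  | .zero => 0
  | .one => 1
  | .vote => 2
  | .manipulator => 3
  | .committee => 4

instance : TreeEnc ApprovalVoting.InputSymbol :=
  ⟨fun s => enc (List.replicate (symbolIndex s) ())⟩

end TreeEnc

namespace PolyFun

variable {α β γ ι : Type} [TreeEnc α] [TreeEnc β] [TreeEnc γ] [Fintype ι]

theorem ofSymbol (g : ApprovalVoting.InputSymbol → β) {f : α → ApprovalVoting.InputSymbol}
    (hf : PolyFun f) : PolyFun fun a => g (f a) := by
  -- A symbol is coded by a unary index below 5, so `n = 4` nested case distinctions compute every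
  -- function of it.
  have key : ∀ (n : ℕ) (h : ℕ → β), PolyFun fun l : List Unit => h (min l.length n) := by
    intro n
    induction n with
    | zero => intro h; simpa using const (α := List Unit) (h 0)
    | succ n ih =>
      intro h
      have := listCases (g := fun _ l (_ : List Unit) => h (min l.length n + 1)) id (const (h 0))
        ((ih fun k => h (k + 1)).comp (by fun_prop))
      convert this using 2 with l
      cases l <;> simp [Nat.add_min_add_right]
  have h₁ : PolyFun fun s : ApprovalVoting.InputSymbol => List.replicate (symbolIndex s) () :=
    of_word_eq fun _ => rfl
  have h₂ := (key 4 fun n => g (if n = 0 then .zero else if n = 1 then .one else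
    if n = 2 then .vote else if n = 3 then .manipulator else .committee)).comp (h₁.comp hf)
  convert h₂ using 2 with a
  cases f a <;> simp [symbolIndex]

theorem listOfConst {κ : Type} (L : List κ) {f : α → κ → β}
    (hf : ∀ i ∈ L, PolyFun fun a => f a i) : PolyFun fun a => L.map (f a) := by
  induction L with
  | nil => exact const []
  | cons i L ih => exact cons (hf i (by simp)) (ih fun j hj => hf j (by simp [hj]))

@[fun_prop]
theorem pi {f : α → ι → β} (hf : ∀ i, PolyFun fun a => f a i) : PolyFun fun a i => f a i :=
  comp (β := List β) (f := _root_.id) (g := fun a => (Finset.univ : Finset ι).toList.map (f a))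
    id (listOfConst _ fun i _ => hf i)

@[fun_prop]
theorem apply [Inhabited β] (i : ι) : PolyFun fun f : ι → β => f i := by
  classical
  have h₁ : PolyFun fun f : ι → β => (Finset.univ : Finset ι).toList.map f :=
    of_word_eq fun _ => rfl
  have h₂ := getDConst default ((Finset.univ : Finset ι).toList.idxOf i) h₁
  convert h₂ using 2 with a
  have : (Finset.univ : Finset ι).toList.idxOf i < (Finset.univ : Finset ι).toList.length :=
    List.idxOf_lt_length_iff.2 (by simp)
  rw [List.getD_eq_getElem _ _ (by simpa using this)]
  simp

@[fun_prop]
theorem finsetSum {f : α → ι → ℕ} (hf : ∀ i, PolyFun fun a => f a i) :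
    PolyFun fun a => ∑ i, f a i := by
  have := listSum (listOfConst (Finset.univ : Finset ι).toList fun i _ => hf i)
  simpa using this

theorem forallFinite {p : α → ι → Prop} [∀ a i, Decidable (p a i)] [∀ a, Decidable (∀ i, p a i)]
    (hp : ∀ i, PolyFun fun a => decide (p a i)) : PolyFun fun a => decide (∀ i, p a i) := by
  have := not (any (listOfConst (Finset.univ : Finset ι).toList fun i _ => hp i)
    (f := fun _ b => !b) (by fun_prop))
  convert this using 2 with a
  rw [Bool.eq_iff_iff]
  simp

end PolyFun

end Finite

/-! ### Reading the input, writing the answer, and the resulting Turing machine -/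

namespace TreeMachine

open ApprovalVoting

/-- Put the input symbol in the register in front of the list on the data stack. -/
def consReg : TreeProg :=
  .ite (fun v => decide (v = some .zero)) (pushAll (true :: word InputSymbol.zero))
    (.ite (fun v => decide (v = some .one)) (pushAll (true :: word InputSymbol.one))
      (.ite (fun v => decide (v = some .vote)) (pushAll (true :: word InputSymbol.vote))
        (.ite (fun v => decide (v = some .manipulator))
          (pushAll (true :: word InputSymbol.manipulator))
          (pushAll (true :: word InputSymbol.committee)))))

/-- Read the input word and put the reversed list of its symbols on the data stack. -/
def readInput : TreeProg := .seq (pushMain fun _ => false) (whileDo popInp Option.isSome consReg)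

/-- Turn the encoding of a bit on the data stack into the bit. -/
def writeBit : TreeProg :=
  .seq popMain (.ite Reg.bit (.seq popMain (.seq popMain (pushMain fun _ => true)))
    (pushMain fun _ => false))

theorem size_symbol_le (s : InputSymbol) : size s ≤ 9 := by cases s <;> decide

theorem run_consReg (s : InputSymbol) (i : List InputSymbol) (m : List Bool)
    (a : List (Option Bool)) (b : List Bool) (c : List Unit) :
    ∃ v' n, n ≤ 15 ∧ Run consReg (some s) (stk i m a b c) v'
      (stk i (true :: (word s ++ m)) a b c) n := by
  obtain ⟨v', n, hn, h⟩ := exec_pushAll (i := i) (m := m) (a := a) (b := b) (c := c)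
    (true :: word s) (some s)
  have hs : (word s).length ≤ 9 := size_symbol_le s
  simp only [List.length_cons] at hn
  cases s
  · exact ⟨v', _, by omega, .iteTrue rfl h⟩
  · exact ⟨v', _, by omega, .iteFalse rfl (.iteTrue rfl h)⟩
  · exact ⟨v', _, by omega, .iteFalse rfl (.iteFalse rfl (.iteTrue rfl h))⟩
  · exact ⟨v', _, by omega, .iteFalse rfl (.iteFalse rfl (.iteFalse rfl (.iteTrue rfl h)))⟩
  · exact ⟨v', _, by omega, .iteFalse rfl (.iteFalse rfl (.iteFalse rfl (.iteFalse rfl h)))⟩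

theorem exec_readInput_loop (i : List InputSymbol) : ∀ l : List InputSymbol,
    Exec (whileDo popInp Option.isSome consReg) (stk i (word l) [] [] [])
      (stk [] (word (i.reverse ++ l)) [] [] []) (17 * i.length + 2) := by
  induction i with
  | nil =>
    intro l
    exact ExecTo.whileDo_done (v := none) (T := 1) (fun v => ⟨1, le_rfl, run_popInp⟩) rfl
  | cons s i ih =>
    intro l
    have := ExecTo.whileDo_step (b := Option.isSome) (v := some s)
      (S := stk (s :: i) (word l) [] [] []) (T := 1)
      (fun v => ⟨1, le_rfl, run_popInp⟩) rfl (run_consReg s i (word l) [] [] []) (ih (s :: l))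
    refine Exec.mono (by simpa using this) ?_
    simp only [List.length_cons]
    omega

theorem exec_readInput (i : List InputSymbol) :
    Exec readInput (stk i [] [] [] []) (stk [] (word i.reverse) [] [] []) (17 * i.length + 3) := by
  have := (exec_pushMain (i := i) (m := []) (a := []) (b := []) (c := []) false).seq
    (exec_readInput_loop i [])
  exact Exec.mono (by simpa [readInput] using this) (by omega)

theorem exec_writeBit (x : Bool) :
    Exec writeBit (stk [] (word x) [] [] []) (stk [] [x] [] [] []) 5 := by
  cases x
  · exact ((execTo_popMain false).seq_iteFalse rfl (exec_pushMain false)).mono (by omega)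
  · exact ((execTo_popMain true).seq_iteTrue rfl ((execTo_popMain false).exec.seq
      ((execTo_popMain false).exec.seq (exec_pushMain true)))).mono (by omega)

/-- The Turing machine of a program, with input stack `inp` and output stack `main`. -/
noncomputable def toTM2 (p : TreeProg) : FinTM2 where
  K := Stack
  k₀ := .inp
  k₁ := .main
  Γ := Sym
  Λ := Option (Label p)
  main := some p.start
  σ := Reg
  initialState := none
  Γk₀Fin := inferInstanceAs (Fintype InputSymbol)
  m
    | some l => p.code some none l
    -- The halting configuration must have the initial register value, so the register is cleared.
    | none => .load (fun _ => none) .halt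

theorem initList_toTM2 (p : TreeProg) (i : List InputSymbol) :
    initList (toTM2 p) i = ⟨some (some p.start), none, stk i [] [] [] []⟩ := by
  unfold initList
  congr 1
  funext k
  cases k <;> rfl

theorem haltList_toTM2 (p : TreeProg) (o : List Bool) :
    haltList (toTM2 p) o = ⟨none, none, stk [] o [] [] []⟩ := by
  unfold haltList
  congr 1
  funext k
  cases k <;> rfl

end TreeMachine

/-- A problem is solvable in polynomial time when it is decided by a polynomial-time function of the
reversed input word. -/
theorem PolyFun.polyTimeSolvable {α : Type} {e : α → List ApprovalVoting.InputSymbol}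
    {P : α → Prop} {f : List ApprovalVoting.InputSymbol → Bool} (hf : PolyFun f)
    (h : ∀ a, f (e a).reverse = true ↔ P a) : ApprovalVoting.PolyTimeSolvable e P := by
  classical
  obtain ⟨-, p, T, ⟨Q, hQ⟩, hp⟩ := hf
  let q : TreeProg := .seq readInput (.seq p writeBit)
  have hexec : ∀ i : List ApprovalVoting.InputSymbol, Exec q (stk i [] [] [] [])
      (stk [] [f i.reverse] [] [] []) (17 * i.length + 8 + Q.eval (10 * i.length + 1)) := by
    intro i
    have h₁ := hp i.reverse [] []
    simp only [List.append_nil] at h₁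
    refine ((exec_readInput i).seq (h₁.seq (exec_writeBit _))).mono ?_
    have h₂ : size i.reverse ≤ 10 * i.length + 1 := by
      have := size_le_of_forall (l := i.reverse) fun s _ => size_symbol_le s
      rw [List.length_reverse] at this
      omega
    have h₃ := (hQ i.reverse).trans (Q.eval_nat_mono h₂)
    simp only at h₃
    omega
  refine ⟨{
    tm := toTM2 q
    inputAlphabet := Equiv.refl _
    outputAlphabet := Equiv.refl _
    -- One step more than in `hexec`, for the halting instruction; `10 n + 1` bounds the code size
    -- of a word of length `n`.
    time := .C 17 * .X + .C 9 + Q.comp (.C 10 * .X + 1)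
    outputsFun := fun a => Classical.choice ?_ }⟩
  obtain ⟨v', n, hn, hr⟩ := hexec (e a) none
  have h₁ := hr.stepsTo (toTM2 q).m some none fun _ => rfl
  have h₂ : StepsTo (toTM2 q).m ⟨some none, v', stk [] [f (e a).reverse] [] [] []⟩
      ⟨none, none, stk [] [f (e a).reverse] [] [] []⟩ 1 := StepsTo.single rfl
  have h₃ := h₁.trans h₂
  refine ⟨⟨⟨n + 1, ?_⟩, ?_⟩⟩
  · have hi : List.map (Equiv.refl ApprovalVoting.InputSymbol).invFun (e a) = e a := List.map_id _
    have ho : (Computability.encodeBool (decide (P a))).map (Equiv.refl Bool).invFun =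
        [f (e a).reverse] := by
      have : f (e a).reverse = decide (P a) := by
        rw [Bool.eq_iff_iff, h]
        simp
      rw [this]
      rfl
    have h₄ : ∀ (i : List ((toTM2 q).Γ (toTM2 q).k₀)) (o : List ((toTM2 q).Γ (toTM2 q).k₁)),
        i = e a → o = [f (e a).reverse] →
        (flip bind (toTM2 q).step)^[n + 1] (some (initList (toTM2 q) i)) =
          some (haltList (toTM2 q) o) := by
      rintro _ _ rfl rfl
      have h₅ := congrArg (fun c => (flip bind (toTM2 q).step)^[n + 1] (some c))
        (initList_toTM2 q (e a))
      exact (h₅.trans h₃).trans (congrArg some (haltList_toTM2 q [f (e a).reverse]).symm)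
    exact h₄ _ _ hi ho
  · simp [Polynomial.eval_comp]
    omega

/-! ### Parsing the input word -/

namespace ApprovalVoting

/-- One step of the parser, which reads the word from its end. -/
def parseStep (s : InputSymbol) (x : List Bool × List (List Bool) × List (List Bool) × List Bool) :
    List Bool × List (List Bool) × List (List Bool) × List Bool :=
  if decide (s = .zero) then (false :: x.1, x.2)
  else if decide (s = .one) then (true :: x.1, x.2)
  else if decide (s = .vote) then ([], x.1 :: x.2.1, x.2.2)
  else if decide (s = .manipulator) then ([], x.2.1, x.1 :: x.2.2.1, x.2.2.2)
  else ([], x.2.1, x.2.2.1, x.1)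

/-- The rows of a reversed input word: the votes, the manipulative votes, and the committee. -/
def parse (l : List InputSymbol) : List (List Bool) × List (List Bool) × List Bool :=
  (l.foldl (fun x s => parseStep s x) ([], [], [], [])).2

/-- The membership row of a set of candidates. -/
def row {m : ℕ} (s : Finset (Fin m)) : List Bool := List.ofFn fun i => decide (i ∈ s)

theorem polyFun_parse : PolyFun parse := by
  unfold parse
  refine .snd (.foldl_of_growth (step := fun _ x s => parseStep s x) .id (.const _) ?_
    (.const 10) fun a c b => ?_)
  · have h (t : InputSymbol) : PolyFun fun x : (List InputSymbol × (List Bool × List (List Bool) ×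
        List (List Bool) × List Bool)) × InputSymbol => decide (x.2 = t) :=
      .ofSymbol (fun s => decide (s = t)) (by fun_prop)
    unfold parseStep
    exact .ite (h _) (by fun_prop) (.ite (h _) (by fun_prop) (.ite (h _) (by fun_prop)
      (.ite (h _) (by fun_prop) (by fun_prop))))
  · obtain ⟨x, V, VM, w⟩ := c
    have h₁ : size true = 3 := rfl
    have h₂ : size false = 1 := rfl
    have h₃ := size_pos w
    cases b <;> simp [parseStep, h₁, h₂] <;> omega

/-- Reading from the end, the bits of a row are met before the mark that opens it; they collect in
the first component until the mark says where the row belongs. -/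
theorem foldr_parseStep_bits {m : ℕ} (s : Finset (Fin m))
    (x : List (List Bool) × List (List Bool) × List Bool) :
    (bits s).foldr parseStep ([], x) = (row s, x) := by
  unfold bits row
  have : ∀ (n : ℕ) (g : Fin n → Prop) [DecidablePred g],
      (List.ofFn fun i => if g i then InputSymbol.one else .zero).foldr parseStep ([], x) =
        (List.ofFn fun i => decide (g i), x) := by
    intro n
    induction n with
    | zero => intro g _; rfl
    | succ n ih =>
      intro g _
      rw [List.ofFn_succ, List.foldr_cons, ih fun i => g i.succ, List.ofFn_succ]
      by_cases h : g 0 <;> simp [parseStep, h]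
  exact this m (· ∈ s)

theorem parse_encode {φ : Rule} (I : ManipulationInstance φ) :
    parse I.encode.reverse = (I.V.map row, I.VM.map row, row I.w) := by
  unfold parse ManipulationInstance.encode
  rw [List.foldl_reverse, List.foldr_append, List.foldr_append, List.foldr_cons,
    foldr_parseStep_bits]
  have h₁ : ∀ l : List (Finset (Fin I.m)),
      (l.flatMap fun v => InputSymbol.manipulator :: bits v).foldr parseStep
        ([], [], [], row I.w) = ([], [], l.map row, row I.w) := by
    intro l
    induction l with
    | nil => rfl
    | cons v l ih =>
      rw [List.flatMap_cons, List.foldr_append, ih, List.foldr_cons, foldr_parseStep_bits]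
      rfl
  have h₂ : ∀ l : List (Finset (Fin I.m)),
      (l.flatMap fun v => InputSymbol.vote :: bits v).foldr parseStep
        ([], [], I.VM.map row, row I.w) = ([], l.map row, I.VM.map row, row I.w) := by
    intro l
    induction l with
    | nil => rfl
    | cons v l ih =>
      rw [List.flatMap_cons, List.foldr_append, ih, List.foldr_cons, foldr_parseStep_bits]
      rfl
  have h₃ : parseStep .committee (row I.w, [], [], []) = ([], [], [], row I.w) := rfl
  rw [h₃, h₁, h₂]

end ApprovalVoting

/-! ### Enumeration of vectors and the dynamic program -/

/-- All functions that vanish outside `L` and take their values on `L` in `l`. -/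
def allFun {ι : Type} [DecidableEq ι] (l : List ℕ) : List ι → List (ι → ℕ)
  | [] => [0]
  | i :: L => (allFun l L).flatMap fun f => l.map fun a => Function.update f i a

theorem mem_allFun {ι : Type} [DecidableEq ι] {l : List ℕ} (L : List ι) : ∀ {f : ι → ℕ},
    (∀ i ∈ L, f i ∈ l) → (∀ i ∉ L, f i = 0) → f ∈ allFun l L := by
  induction L with
  | nil =>
    intro f _ h
    exact List.mem_singleton.2 (funext fun i => h i (by simp))
  | cons i L ih =>
    intro f hf hf'
    -- If `i` occurs again in `L`, then `f` itself is already listed for `L`; otherwise its value at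
    -- `i` is reset first.
    refine List.mem_flatMap.2 ⟨if i ∈ L then f else Function.update f i 0, ih ?_ ?_,
      List.mem_map.2 ⟨f i, hf i (by simp), ?_⟩⟩
    · intro j hj
      split_ifs with hi
      · exact hf j (by simp [hj])
      · have : j ≠ i := fun h => hi (h ▸ hj)
        simpa [this] using hf j (by simp [hj])
    · intro j hj
      split_ifs with hi
      · exact hf' j (by simp [hj]; rintro rfl; exact hj hi)
      · by_cases h : j = i
        · simp [h]
        · simpa [h] using hf' j (by simp [hj, h])
    · split_ifs <;> simp

/-- The states that are reachable by adding, for every `j < m`, the vector `δ j S` for a choice of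
`S`, through states in the list `all`. -/
def reach {ι τ : Type} [Fintype ι] (all : List (ι → ℕ)) (choices : List τ) (δ : ℕ → τ → ι → ℕ)
    (l : List ℕ) : List (ι → ℕ) :=
  l.foldl (fun R j => all.filter fun v => R.any fun u => choices.any fun S =>
    decide (∀ c, v c = u c + δ j S c)) [0]

/-- Every round adds at most 1 to each coordinate, so partial sums never exceed `m` and filtering
the list `all` loses no reachable vector. -/
theorem mem_reach {ι τ : Type} [Fintype ι] {all : List (ι → ℕ)} {choices : List τ}
    {δ : ℕ → τ → ι → ℕ} {m : ℕ} (hall : ∀ v : ι → ℕ, (∀ c, v c ≤ m) → v ∈ all)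
    (hchoices : ∀ S, S ∈ choices) (hδ : ∀ j S c, δ j S c ≤ 1) [Inhabited τ] {v : ι → ℕ} :
    v ∈ reach all choices δ (List.range m) ↔
      ∃ f : ℕ → τ, ∀ c, v c = ∑ j ∈ Finset.range m, δ j (f j) c := by
  have key : ∀ n, n ≤ m → ∀ v, v ∈ reach all choices δ (List.range n) ↔
      ∃ f : ℕ → τ, ∀ c, v c = ∑ j ∈ Finset.range n, δ j (f j) c := by
    intro n
    induction n with
    | zero =>
      intro _ v
      simp only [reach, List.range_zero, List.foldl_nil, List.mem_singleton, Finset.range_zero,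
        Finset.sum_empty, exists_const]
      exact funext_iff
    | succ n ih =>
      intro hn v
      have ih := ih (by omega)
      unfold reach at ih
      simp only [reach, List.range_succ, List.foldl_append, List.foldl_cons, List.foldl_nil,
        List.mem_filter, List.any_eq_true, decide_eq_true_eq, ih, Finset.sum_range_succ]
      constructor
      · rintro ⟨-, u, ⟨f, hf⟩, S, -, h⟩
        refine ⟨Function.update f n S, fun c => ?_⟩
        rw [h, hf, Function.update_self]
        congr 1
        refine Finset.sum_congr rfl fun j hj => ?_
        rw [Function.update_of_ne (by simp at hj; omega)]
      · rintro ⟨f, hf⟩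
        refine ⟨hall v fun c => ?_, _, ⟨f, fun c => rfl⟩, f n, hchoices _, hf⟩
        rw [hf, ← Finset.sum_range_succ (fun j => δ j (f j) c)]
        refine (Finset.sum_le_card_nsmul _ _ 1 fun j _ => hδ _ _ _).trans ?_
        simpa using hn
  exact key m le_rfl v

namespace PolyFun

variable {α τ ι : Type} [TreeEnc α] [TreeEnc τ] [Fintype ι]

@[fun_prop]
theorem allFun [DecidableEq ι] (L : List ι) {l : α → List ℕ} (hl : PolyFun l) :
    PolyFun fun a => _root_.allFun (l a) L := by
  induction L with
  | nil => exact const [0]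
  | cons i L ih =>
    refine flatMap ih (map (by fun_prop) (pi fun j => ?_))
    by_cases h : j = i
    · subst h
      simp only [Function.update_self]
      fun_prop
    · simp only [Function.update_of_ne h]
      fun_prop

@[fun_prop]
theorem reach {all : α → List (ι → ℕ)} {choices : α → List τ} {δ : α → ℕ → τ → ι → ℕ}
    {l : α → List ℕ} (hall : PolyFun all) (hchoices : PolyFun choices)
    (hδ : PolyFun fun x : α × ℕ × τ => δ x.1 x.2.1 x.2.2) (hl : PolyFun l) :
    PolyFun fun a => _root_.reach (all a) (choices a) (δ a) (l a) := by
  -- After each round the accumulator is a sublist of `all a`, whose size does not depend on the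
  -- round.
  refine foldl_of_growth (step := fun a (R : List (ι → ℕ)) j =>
      (all a).filter fun v => R.any fun u => (choices a).any fun S =>
        decide (∀ c, v c = u c + δ a j S c)) hl (const [0]) ?_
    (hall.1.comp (fst (γ := ℕ) id).1) (fun a c b =>
      (size_le_of_sublist List.filter_sublist).trans (Nat.le_add_left _ _))
  refine filter (by fun_prop) (any (by fun_prop) (any (by fun_prop) (forallFinite fun c => ?_)))
  have h : PolyFun fun x : α × ℕ × τ => δ x.1 x.2.1 x.2.2 c := by fun_prop
  have h₂ := h.comp (g := fun x : (((((α × List (ι → ℕ)) × ℕ) × (ι → ℕ)) × (ι → ℕ)) × τ) =>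
    (x.1.1.1.1.1, x.1.1.1.2, x.2)) (by fun_prop)
  simp only at h₂
  fun_prop

end PolyFun

/-! ### The decision algorithm and its polynomial running time -/

namespace ApprovalVoting

/-- `m! / (b - a)` for `a < b ≤ m`, and `0` for `b ≤ a`, where `m` is the length of `w`. -/
def recip (w : List Bool) (a b : ℕ) : ℕ :=
  if b ≤ a then 0
  else ((List.range w.length).map fun i => if i + 1 + a = b then 1 else i + 1).prod

/-- The scaled score that a vote with `j` approved candidates gives to each of them, up to a term
that depends on the vote only. -/
def Rule.weight (φ : Rule) (w : List Bool) (j : ℕ) : ℕ :=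
  match φ with
  | SAV => recip w 0 j
  | NSAV => recip w 0 j + recip w j w.length

/-- The number of candidates in a row. -/
def trues (r : List Bool) : ℕ := (r.map fun b => if b then 1 else 0).sum

variable {t : ℕ}

/-- The scaled score of candidate `j` when the manipulators with `S i` approve it, and the new vote
of manipulator `i` has size `z i`. -/
def Rule.points (φ : Rule) (x : List (List Bool) × List (List Bool) × List Bool) (z : Fin t → ℕ)
    (j : ℕ) (S : Fin t → Bool) : ℕ :=
  (x.1.map fun r => if r.getD j false then φ.weight x.2.2 (trues r) else 0).sum +
    ∑ i, if S i then φ.weight x.2.2 (z i) else 0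

/-- The counters of the dynamic program: the candidates above the threshold, those at the threshold,
and for each manipulator the size of the new vote and the numbers of approved candidates above the
threshold, of not approved candidates at the threshold, and of approved candidates of the
old committee at the threshold and below it. -/
inductive Counter (t : ℕ) : Type
  | above
  | level
  | vote (i : Fin t)
  | aboveIn (i : Fin t)
  | levelOut (i : Fin t)
  | lostLevel (i : Fin t)
  | lostBelow (i : Fin t)
  deriving DecidableEq, Fintype

/-- Whether candidate `j` is truly approved by manipulator `i`. -/
def approves (x : List (List Bool) × List (List Bool) × List Bool) (i j : ℕ) : Bool :=
  (x.2.1.getD i []).getD j false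

/-- Whether a counter counts candidate `j`. -/
def counts (x : List (List Bool) × List (List Bool) × List Bool) (θ s j : ℕ) (S : Fin t → Bool) :
    Counter t → Bool
  | .above => decide (θ < s)
  | .level => decide (s = θ)
  | .vote i => S i
  | .aboveIn i => approves x i j && decide (θ < s)
  | .levelOut i => !approves x i j && decide (s = θ)
  | .lostLevel i => approves x i j && x.2.2.getD j false && decide (s = θ)
  | .lostBelow i => approves x i j && x.2.2.getD j false && decide (s < θ)

/-- The number of approved candidates of manipulator `i` in the old committee. -/
def oldCount (x : List (List Bool) × List (List Bool) × List Bool) (i : ℕ) : ℕ :=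
  ((List.range x.2.2.length).map fun j =>
    if approves x i j && x.2.2.getD j false then 1 else 0).sum

/-- Whether manipulator `i` is satisfied with all winning committees, given the counters. -/
def satisfied (sub : Bool) (x : List (List Bool) × List (List Bool) × List Bool)
    (v : Counter t → ℕ) (i : Fin t) : Bool :=
  (decide (oldCount x i < v (.aboveIn i)) ||
    decide (oldCount x i + v .above + v (.levelOut i) < v (.aboveIn i) + trues x.2.2)) &&
  (!sub || (decide (v (.lostBelow i) = 0) &&
    (decide (v (.lostLevel i) = 0) || decide (v .above + v .level = trues x.2.2))))

/-- Whether the counters show a successful manipulation with votes of sizes `z`. -/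
def accepts (sub : Bool) (x : List (List Bool) × List (List Bool) × List Bool) (z : Fin t → ℕ)
    (v : Counter t → ℕ) : Bool :=
  decide (v .above ≤ trues x.2.2) && decide (trues x.2.2 ≤ v .above + v .level) &&
    decide (∀ i, v (.vote i) = z i) && decide (∀ i, satisfied sub x v i = true)

/-- The decision for exactly `t` manipulators. -/
noncomputable def solveExact (φ : Rule) (sub : Bool) (t : ℕ)
    (x : List (List Bool) × List (List Bool) × List Bool) : Bool :=
  (allFun (List.range (false :: x.2.2).length) (Finset.univ : Finset (Fin t)).toList).any fun z =>
    (List.range x.2.2.length).any fun j₀ =>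
      (Finset.univ : Finset (Fin t → Bool)).toList.any fun S₀ =>
        (reach (allFun (List.range (false :: x.2.2).length)
              (Finset.univ : Finset (Counter t)).toList)
            (Finset.univ : Finset (Fin t → Bool)).toList
            (fun j S c => if counts x (φ.points x z j₀ S₀) (φ.points x z j S) j S c then 1 else 0)
            (List.range x.2.2.length)).any
          fun v => accepts sub x z v

/-- The decision for at most `t` manipulators. -/
noncomputable def solve (φ : Rule) (sub : Bool) : ℕ →
    List (List Bool) × List (List Bool) × List Bool → Bool
  | 0, _ => true
  | t + 1, x =>
    if decide (x.2.1.length = t + 1) then solveExact φ sub (t + 1) x else solve φ sub t x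

section PolyFun

variable {α : Type} [TreeEnc α] {x : α → List (List Bool) × List (List Bool) × List Bool}

@[fun_prop]
theorem polyFun_recip {w : α → List Bool} {a b : α → ℕ} (hw : PolyFun w) (ha : PolyFun a)
    (hb : PolyFun b) : PolyFun fun y => recip (w y) (a y) (b y) := by
  unfold recip
  fun_prop

@[fun_prop]
theorem Rule.polyFun_weight (φ : Rule) {w : α → List Bool} {j : α → ℕ} (hw : PolyFun w)
    (hj : PolyFun j) : PolyFun fun y => φ.weight (w y) (j y) := by
  cases φ <;> unfold weight <;> fun_prop

@[fun_prop]
theorem polyFun_trues {r : α → List Bool} (hr : PolyFun r) : PolyFun fun y => trues (r y) := by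
  unfold trues
  fun_prop

@[fun_prop]
theorem Rule.polyFun_points (φ : Rule) {z : α → Fin t → ℕ} {j : α → ℕ} {S : α → Fin t → Bool}
    (hx : PolyFun x) (hz : PolyFun z) (hj : PolyFun j) (hS : PolyFun S) :
    PolyFun fun y => φ.points (x y) (z y) (j y) (S y) := by
  unfold points
  fun_prop

@[fun_prop]
theorem polyFun_approves {i j : α → ℕ} (hx : PolyFun x) (hi : PolyFun i) (hj : PolyFun j) :
    PolyFun fun y => approves (x y) (i y) (j y) := by
  unfold approves
  fun_prop

theorem polyFun_counts {θ s j : α → ℕ} {S : α → Fin t → Bool} (hx : PolyFun x) (hθ : PolyFun θ)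
    (hs : PolyFun s) (hj : PolyFun j) (hS : PolyFun S) (c : Counter t) :
    PolyFun fun y => counts (x y) (θ y) (s y) (j y) (S y) c := by
  cases c <;> unfold counts <;> fun_prop

@[fun_prop]
theorem polyFun_oldCount {i : α → ℕ} (hx : PolyFun x) (hi : PolyFun i) :
    PolyFun fun y => oldCount (x y) (i y) := by
  unfold oldCount
  fun_prop

theorem polyFun_satisfied (sub : Bool) {v : α → Counter t → ℕ} (hx : PolyFun x) (hv : PolyFun v)
    (i : Fin t) : PolyFun fun y => satisfied sub (x y) (v y) i := by
  unfold satisfied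
  fun_prop

@[fun_prop]
theorem polyFun_accepts (sub : Bool) {z : α → Fin t → ℕ} {v : α → Counter t → ℕ}
    (hx : PolyFun x) (hz : PolyFun z) (hv : PolyFun v) :
    PolyFun fun y => accepts sub (x y) (z y) (v y) := by
  unfold accepts
  have h₁ : PolyFun fun y => decide (∀ i, v y (.vote i) = z y i) :=
    .forallFinite fun i => by fun_prop
  have h₂ : PolyFun fun y => decide (∀ i, satisfied sub (x y) (v y) i = true) :=
    .forallFinite fun i => .decideEqTrue (polyFun_satisfied sub hx hv i)
  fun_prop

theorem polyFun_solveExact (φ : Rule) (sub : Bool) (t : ℕ) :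
    PolyFun (solveExact φ sub t) := by
  unfold solveExact
  refine .any (by fun_prop) (.any ?_ (.any (by fun_prop) (.any (.reach ?_ (by fun_prop) ?_ ?_)
    (by fun_prop))))
  · fun_prop
  · fun_prop
  · refine .pi fun c => .ite (polyFun_counts ?_ ?_ ?_ ?_ ?_ c) (.const 1) (.const 0) <;> fun_prop
  · fun_prop

theorem polyFun_solve (φ : Rule) (sub : Bool) (t : ℕ) : PolyFun (solve φ sub t) := by
  induction t with
  | zero => exact .const true
  | succ t ih =>
    have := polyFun_solveExact φ sub (t + 1)
    change PolyFun fun x : List (List Bool) × List (List Bool) × List Bool =>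
      if decide (x.2.1.length = t + 1) then solveExact φ sub (t + 1) x else solve φ sub t x
    fun_prop

end PolyFun

end ApprovalVoting

/-! ### Winning committees described by a threshold -/

namespace ApprovalVoting

section Threshold

variable {α : Type} [DecidableEq α]

theorem exists_committee_between {D E : Finset α} {k : ℕ} (h₁ : D.card ≤ k)
    (h₂ : k ≤ (D ∪ E).card) : ∃ w : Finset α, w.card = k ∧ D ⊆ w ∧ w ⊆ D ∪ E := by
  obtain ⟨w, hw, hw', hk⟩ :=
    Finset.exists_subsuperset_card_eq (Finset.subset_union_left (s₁ := D) (s₂ := E)) h₁ h₂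
  exact ⟨w, hk, hw, hw'⟩

/-- The sets of size `k` with the maximum sum are those between the set of points above the
threshold and the set of points at least at the threshold. -/
theorem maximal_iff_between [Fintype α] (s : α → ℕ) (θ k : ℕ)
    (h₁ : (Finset.univ.filter fun c => θ < s c).card ≤ k)
    (h₂ : k ≤ ((Finset.univ.filter fun c => θ < s c) ∪ Finset.univ.filter fun c => s c = θ).card)
    {w : Finset α} (hw : w.card = k) :
    (∀ w' : Finset α, w'.card = k → ∑ c ∈ w', s c ≤ ∑ c ∈ w, s c) ↔
      (Finset.univ.filter fun c => θ < s c) ⊆ w ∧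
        w ⊆ (Finset.univ.filter fun c => θ < s c) ∪ Finset.univ.filter fun c => s c = θ := by
  set D := Finset.univ.filter fun c => θ < s c with hD
  set E := Finset.univ.filter fun c => s c = θ with hE
  -- Subtracting the threshold changes the sums of all `k`-sets by the same amount and makes points
  -- above it positive, at it zero and below it negative. Hence `D` has the maximum sum of `g` among
  -- all sets.
  let g : α → ℤ := fun c => (s c : ℤ) - θ
  have hg : ∀ w : Finset α, w.card = k → ∑ c ∈ w, g c = ((∑ c ∈ w, s c : ℕ) : ℤ) - k * θ := by
    intro w hw
    simp [g, Finset.sum_sub_distrib, hw]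
  have hsplit : ∀ w : Finset α,
      ∑ c ∈ w, g c + ∑ c ∈ D \ w, g c = ∑ c ∈ D, g c + ∑ c ∈ w \ D, g c := by
    intro w
    have h₃ := Finset.sum_inter_add_sum_sdiff w D g
    have h₄ := Finset.sum_inter_add_sum_sdiff D w g
    rw [Finset.inter_comm] at h₄
    linarith
  have hpos : ∀ w : Finset α, ∀ c ∈ D \ w, 0 < g c := by
    intro w c hc
    simp [hD] at hc
    simp only [g]
    omega
  have hneg : ∀ w : Finset α, ∀ c ∈ w \ D, g c ≤ 0 := by
    intro w c hc
    simp [hD] at hc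
    simp only [g]
    omega
  have hle : ∀ w : Finset α, ∑ c ∈ w, g c ≤ ∑ c ∈ D, g c := by
    intro w
    have h₃ := hsplit w
    have h₄ := Finset.sum_nonneg fun c hc => (hpos w c hc).le
    have h₅ := Finset.sum_nonpos (hneg w)
    linarith
  have heq : ∀ w : Finset α, ∑ c ∈ w, g c = ∑ c ∈ D, g c ↔ D ⊆ w ∧ w ⊆ D ∪ E := by
    intro w
    have h₃ := hsplit w
    have h₄ := Finset.sum_nonneg fun c hc => (hpos w c hc).le
    have h₅ := Finset.sum_nonpos (hneg w)
    constructor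
    · intro h
      have h₆ : ∑ c ∈ D \ w, g c = 0 := by linarith
      have h₇ : ∑ c ∈ w \ D, g c = 0 := by linarith
      rw [Finset.sum_eq_zero_iff_of_nonneg fun c hc => (hpos w c hc).le] at h₆
      rw [Finset.sum_eq_zero_iff_of_nonpos (hneg w)] at h₇
      constructor
      · intro c hc
        by_contra hcw
        have hm : c ∈ D \ w := Finset.mem_sdiff.2 ⟨hc, hcw⟩
        exact (hpos w c hm).ne' (h₆ c hm)
      · intro c hc
        by_cases hcD : c ∈ D
        · exact Finset.mem_union_left _ hcD
        · have := h₇ c (Finset.mem_sdiff.2 ⟨hc, hcD⟩)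
          refine Finset.mem_union_right _ ?_
          simp only [g] at this
          simp only [hE, Finset.mem_filter, Finset.mem_univ, true_and]
          omega
    · rintro ⟨h, h'⟩
      have h₆ : D \ w = ∅ := Finset.sdiff_eq_empty_iff_subset.2 h
      have h₇ : ∑ c ∈ w \ D, g c = 0 := Finset.sum_eq_zero fun c hc => by
        have hc := Finset.mem_sdiff.1 hc
        have := h' hc.1
        simp only [Finset.mem_union, hc.2, false_or] at this
        simp only [hE, Finset.mem_filter, Finset.mem_univ, true_and] at this
        simp [g, this]
      rw [h₆, h₇] at h₃
      simpa using h₃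
  -- The bound by the sum over `D` is attained by some set of size `k`, so maximality means
  -- equality.
  obtain ⟨w₀, hw₀, hw₀'⟩ := exists_committee_between h₁ h₂
  rw [← heq]
  constructor
  · intro h
    have h₃ := h w₀ hw₀
    have h₄ := (heq w₀).2 hw₀'
    have h₅ := hg w hw
    have h₆ := hg w₀ hw₀
    have h₇ := hle w
    zify at h₃
    push_cast at h₅ h₆
    linarith
  · intro h w' hw'
    have h₃ := hg w hw
    have h₄ := hg w' hw'
    have h₅ := hle w'
    zify
    push_cast at h₃ h₄
    linarith

/-- There is a candidate whose score is a threshold. -/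
theorem exists_threshold [Fintype α] [Nonempty α] (s : α → ℕ) {k : ℕ} (hk : k ≤ Fintype.card α) :
    ∃ c₀, (Finset.univ.filter fun c => s c₀ < s c).card ≤ k ∧
      k ≤ ((Finset.univ.filter fun c => s c₀ < s c) ∪
        Finset.univ.filter fun c => s c = s c₀).card := by
  have hunion : ∀ θ, ((Finset.univ.filter fun c => θ < s c) ∪
      Finset.univ.filter fun c => s c = θ) = Finset.univ.filter fun c => θ ≤ s c := by
    intro θ
    ext c
    simp
    omega
  simp only [hunion]
  obtain ⟨c₁, -, h₁⟩ := Finset.exists_min_image Finset.univ s Finset.univ_nonempty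
  have hne : (Finset.univ.filter fun c => k ≤ (Finset.univ.filter fun d => s c ≤ s d).card).Nonempty :=
    ⟨c₁, by
      simp only [Finset.mem_filter, Finset.mem_univ, true_and]
      rwa [Finset.filter_true_of_mem fun d hd => h₁ d hd]⟩
  -- The threshold is the largest score that at least `k` points reach. If more than `k` points were
  -- above it, the least score among those would be a larger choice.
  obtain ⟨c₀, hc₀, h₀⟩ := Finset.exists_max_image _ s hne
  simp only [Finset.mem_filter, Finset.mem_univ, true_and] at hc₀ h₀
  refine ⟨c₀, ?_, hc₀⟩
  by_contra! hlt
  have hne₂ : (Finset.univ.filter fun c => s c₀ < s c).Nonempty :=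
    Finset.card_pos.1 (by omega)
  obtain ⟨c₂, hc₂, h₂⟩ := Finset.exists_min_image _ s hne₂
  simp only [Finset.mem_filter, Finset.mem_univ, true_and] at hc₂ h₂
  have := h₀ c₂ (hlt.le.trans (Finset.card_le_card fun c hc => by
    simp only [Finset.mem_filter, Finset.mem_univ, true_and] at hc ⊢
    exact h₂ c hc))
  omega

/-- The worst committee fills the `k - |D|` places left by `D` with members of `E \ v` as far as
possible. It contains `|v ∩ D| + max(0, k - |D| - |E \ v|)` elements of `v`, and the disjunction
spells out this maximum. -/
theorem forall_between_card_lt_iff {D E v : Finset α} (hDE : Disjoint D E) {k b : ℕ}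
    (h₁ : D.card ≤ k) (h₂ : k ≤ (D ∪ E).card) :
    (∀ w : Finset α, w.card = k → D ⊆ w → w ⊆ D ∪ E → b < (v ∩ w).card) ↔
      b < (v ∩ D).card ∨ b + D.card + (E \ v).card < (v ∩ D).card + k := by
  rw [Finset.card_union_of_disjoint hDE] at h₂
  constructor
  · intro h
    obtain ⟨X, hXE, hXk, hX⟩ : ∃ X ⊆ E, X.card = k - D.card ∧ (X ⊆ E \ v ∨ E \ v ⊆ X) := by
      rcases le_total (k - D.card) (E \ v).card with h₃ | h₃
      · obtain ⟨X, hX, hXk⟩ := Finset.exists_subset_card_eq h₃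
        exact ⟨X, hX.trans Finset.sdiff_subset, hXk, Or.inl hX⟩
      · obtain ⟨X, hX, hXE, hXk⟩ := Finset.exists_subsuperset_card_eq
          (Finset.sdiff_subset (s := E) (t := v)) h₃ (by omega)
        exact ⟨X, hXE, hXk, Or.inr hX⟩
    have hDX : Disjoint D X := Finset.disjoint_of_subset_right hXE hDE
    have h₄ := h (D ∪ X) (by rw [Finset.card_union_of_disjoint hDX, hXk]; omega)
      Finset.subset_union_left (Finset.union_subset_union_right hXE)
    rw [Finset.inter_union_distrib_left, Finset.card_union_of_disjoint
      (Finset.disjoint_of_subset_left Finset.inter_subset_right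
        (Finset.disjoint_of_subset_right Finset.inter_subset_right hDX))] at h₄
    have h₅ := Finset.card_inter_add_card_sdiff X v
    rw [Finset.inter_comm] at h₅
    rcases hX with hX | hX
    · left
      have : X \ v = X := by
        ext c
        simp only [Finset.mem_sdiff, and_iff_left_iff_imp]
        exact fun hc => (Finset.mem_sdiff.1 (hX hc)).2
      rw [this] at h₅
      omega
    · right
      have : X \ v = E \ v := by
        apply Finset.Subset.antisymm (Finset.sdiff_subset_sdiff hXE le_rfl)
        exact fun c hc => Finset.mem_sdiff.2 ⟨hX hc, (Finset.mem_sdiff.1 hc).2⟩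
      rw [this] at h₅
      omega
  · intro h w hw hDw hwE
    have h₃ : (v ∩ w).card = (v ∩ D).card + (v ∩ (w \ D)).card := by
      rw [← Finset.card_union_of_disjoint, ← Finset.inter_union_distrib_left,
        Finset.union_sdiff_of_subset hDw]
      exact Finset.disjoint_of_subset_left Finset.inter_subset_right
        (Finset.disjoint_of_subset_right Finset.inter_subset_right Finset.disjoint_sdiff)
    have h₄ := Finset.card_inter_add_card_sdiff (w \ D) v
    rw [Finset.inter_comm, Finset.card_sdiff_of_subset hDw, hw] at h₄
    have h₅ : ((w \ D) \ v).card ≤ (E \ v).card := by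
      refine Finset.card_le_card fun c hc => ?_
      simp only [Finset.mem_sdiff] at hc ⊢
      have := hwE hc.1.1
      simp only [Finset.mem_union, hc.1.2, false_or] at this
      exact ⟨this, hc.2⟩
    omega

/-- An element of `E` can be left out of a suitable committee unless the committee must take all of
`E`. -/
theorem forall_between_subset_iff {D E y : Finset α} (hDE : Disjoint D E) {k : ℕ}
    (h₁ : D.card ≤ k) (h₂ : k ≤ (D ∪ E).card) :
    (∀ w : Finset α, w.card = k → D ⊆ w → w ⊆ D ∪ E → y ⊆ w) ↔
      y ⊆ D ∪ E ∧ (Disjoint y E ∨ D.card + E.card = k) := by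
  have hcard := Finset.card_union_of_disjoint hDE
  constructor
  · intro h
    obtain ⟨w₀, hw₀, hw₀', hw₀''⟩ := exists_committee_between h₁ h₂
    refine ⟨(h w₀ hw₀ hw₀' hw₀'').trans hw₀'', ?_⟩
    by_contra! hc
    obtain ⟨hyE, hne⟩ := hc
    obtain ⟨c, hcy, hcE⟩ := Finset.not_disjoint_iff.1 hyE
    obtain ⟨w, hDw, hwE, hw⟩ := Finset.exists_subsuperset_card_eq (n := k)
      (Finset.subset_union_left (s₁ := D) (s₂ := E.erase c)) h₁ (by
        rw [Finset.card_union_of_disjoint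
          (Finset.disjoint_of_subset_right (Finset.erase_subset _ _) hDE),
          Finset.card_erase_of_mem hcE]
        have := Finset.card_pos.2 ⟨c, hcE⟩
        omega)
    have := hwE (h w hw hDw (hwE.trans (Finset.union_subset_union_right
      (Finset.erase_subset _ _))) hcy)
    simp only [Finset.mem_union, Finset.mem_erase, ne_eq, not_true_eq_false, false_and,
      or_false] at this
    exact Finset.disjoint_left.1 hDE this hcE
  · rintro ⟨hy, h⟩ w hw hDw hwE c hc
    rcases h with h | h
    · have := hy hc
      simp only [Finset.mem_union, Finset.disjoint_left.1 h hc, or_false] at this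
      exact hDw this
    · have : w = D ∪ E := Finset.eq_of_subset_of_card_le hwE (by omega)
      exact this ▸ hy hc

end Threshold

/-! ### Scores as natural numbers -/

section Scores

variable {m : ℕ}

@[simp]
theorem length_row (s : Finset (Fin m)) : (row s).length = m := by simp [row]

@[simp]
theorem getElem_row (s : Finset (Fin m)) (j : Fin m) (h : (j : ℕ) < (row s).length) :
    (row s)[(j : ℕ)] = decide (j ∈ s) := by
  simp [row]

theorem getD_row (s : Finset (Fin m)) (j : Fin m) : (row s).getD j false = decide (j ∈ s) := by
  rw [List.getD_eq_getElem _ _ (by simp), getElem_row]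

theorem sum_map_range_fin (f : ℕ → ℕ) :
    ((List.range m).map f).sum = ∑ j : Fin m, f j := by
  rw [← Finset.sum_range]
  rfl

@[simp]
theorem trues_row (s : Finset (Fin m)) : trues (row s) = s.card := by
  unfold trues row
  rw [List.map_ofFn, List.sum_ofFn]
  simp

/-- The product runs over `1, …, m` with the factor `b - a` replaced by 1. For `b ≤ a` both sides
vanish by the convention `x / 0 = 0`, which also takes care of the votes `∅` and `C` left out of the
scores. -/
theorem recip_eq {w : List Bool} {a b : ℕ} (hb : b ≤ w.length) :
    (recip w a b : ℚ) = (w.length.factorial : ℚ) / ((b - a : ℕ) : ℚ) := by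
  unfold recip
  split_ifs with h
  · simp [Nat.sub_eq_zero_of_le h]
  · have hpos : 0 < b - a := by omega
    have key : ∀ n, (((List.range n).map fun i => if i + 1 + a = b then 1 else i + 1).prod) *
        (if b - a ≤ n then b - a else 1) = n.factorial := by
      intro n
      induction n with
      | zero => simp; omega
      | succ n ih =>
        rw [List.range_succ, List.map_append, List.prod_append, Nat.factorial_succ, ← ih]
        simp only [List.map_cons, List.map_nil, List.prod_cons, List.prod_nil, mul_one]
        by_cases h₁ : n + 1 + a = b
        · have h₂ : ¬ b - a ≤ n := by omega
          have h₃ : b - a = n + 1 := by omega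
          simp [h₁, h₃]
          ring
        · by_cases h₂ : b - a ≤ n
          · have h₃ : b - a ≤ n + 1 := by omega
            simp [h₁, h₂, h₃]
            ring
          · have h₃ : ¬ b - a ≤ n + 1 := by omega
            simp [h₁, h₂, h₃]
            ring
    have h₁ := key w.length
    rw [if_pos (by omega)] at h₁
    rw [← h₁, eq_div_iff (by positivity)]
    push_cast
    rfl

/-- The scaled score of a candidate in an election, up to a term that depends on the votes only. -/
def Rule.candPoints (φ : Rule) (w : List Bool) (A : Multiset (Finset (Fin m))) (c : Fin m) : ℕ :=
  (A.map fun v => if c ∈ v then φ.weight w v.card else 0).sum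

theorem savScore_cons (v : Finset (Fin m)) (A : Multiset (Finset (Fin m))) (w : Finset (Fin m)) :
    savScore (v ::ₘ A) w = ((v ∩ w).card : ℚ) / v.card + savScore A w := by
  unfold savScore
  by_cases h : v = ∅
  · simp [h]
  · rw [Multiset.filter_cons_of_pos (p := fun v => v ≠ ∅) _ h]
    simp

theorem nsavScore_cons (v : Finset (Fin m)) (A : Multiset (Finset (Fin m)))
    (w : Finset (Fin m)) :
    nsavScore (v ::ₘ A) w = ((v ∩ w).card : ℚ) / v.card -
      ((w \ v).card : ℚ) / ((m : ℚ) - v.card) + nsavScore A w := by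
  unfold nsavScore
  rw [savScore_cons]
  by_cases h : v = Finset.univ
  · simp [h]
    ring
  · rw [Multiset.filter_cons_of_pos (p := fun v => v ≠ Finset.univ) _ h]
    simp
    ring

/-- Since `|w \ v| = |w| - |v ∩ w|`, the NSAV penalty is a reward `1 / (m - |v|)` for each element
of `v ∩ w`, minus a multiple of `|w|`. That multiple is the same for all committees of one size. -/
theorem Rule.score_cons (φ : Rule) {r : List Bool} (hr : r.length = m) (v : Finset (Fin m)) :
    ∃ K : ℚ, ∀ (A : Multiset (Finset (Fin m))) (w : Finset (Fin m)),
      (m.factorial : ℚ) * φ.score (v ::ₘ A) w =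
        (∑ c ∈ w, if c ∈ v then φ.weight r v.card else 0 : ℕ) - K * w.card +
          m.factorial * φ.score A w := by
  have hv : v.card ≤ m := by simpa using Finset.card_le_univ v
  have hsum : ∀ (n : ℕ) (w : Finset (Fin m)),
      (∑ c ∈ w, if c ∈ v then n else 0) = (v ∩ w).card * n := by
    intro n w
    rw [← Finset.sum_filter, Finset.sum_const, smul_eq_mul, Finset.filter_mem_eq_inter,
      Finset.inter_comm]
  have h₁ := recip_eq (w := r) (a := 0) (b := v.card) (by omega)
  have h₂ := recip_eq (w := r) (a := v.card) (b := r.length) le_rfl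
  rw [hr] at h₁ h₂
  rw [Nat.cast_sub hv] at h₂
  rw [Nat.sub_zero] at h₁
  cases φ with
  | SAV =>
    refine ⟨0, fun A w => ?_⟩
    rw [hsum]
    simp only [score, savScore_cons, weight, Nat.cast_mul, h₁]
    ring
  | NSAV =>
    refine ⟨m.factorial / (m - v.card), fun A w => ?_⟩
    rw [hsum]
    have h₃ : ((w \ v).card : ℚ) = w.card - (v ∩ w).card := by
      have := Finset.card_inter_add_card_sdiff w v
      rw [Finset.inter_comm] at this
      rw [← this]
      push_cast
      ring
    simp only [score, nsavScore_cons, weight, Nat.cast_mul, Nat.cast_add, hr, h₁, h₂, h₃]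
    ring

theorem Rule.score_eq (φ : Rule) {r : List Bool} (hr : r.length = m)
    (A : Multiset (Finset (Fin m))) :
    ∃ K : ℚ, ∀ w : Finset (Fin m), (m.factorial : ℚ) * φ.score A w =
      (∑ c ∈ w, φ.candPoints r A c : ℕ) - K * w.card := by
  induction A using Multiset.induction_on with
  | empty => exact ⟨0, fun w => by cases φ <;> simp [candPoints, score, savScore, nsavScore]⟩
  | cons v A ih =>
    obtain ⟨K, hK⟩ := ih
    obtain ⟨K', hK'⟩ := φ.score_cons hr v
    refine ⟨K' + K, fun w => ?_⟩
    rw [hK', hK]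
    simp only [candPoints, Multiset.map_cons, Multiset.sum_cons, Finset.sum_add_distrib]
    push_cast
    ring

theorem Rule.mem_winning_iff (φ : Rule) {r : List Bool} (hr : r.length = m)
    (A : Multiset (Finset (Fin m))) (k : ℕ) (w : Finset (Fin m)) :
    w ∈ φ.winning A k ↔ w.card = k ∧ ∀ w' : Finset (Fin m), w'.card = k →
      ∑ c ∈ w', φ.candPoints r A c ≤ ∑ c ∈ w, φ.candPoints r A c := by
  obtain ⟨K, hK⟩ := φ.score_eq hr A
  have hm : (0 : ℚ) < m.factorial := by exact_mod_cast m.factorial_pos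
  refine and_congr_right fun hw => forall_congr' fun w' => imp_congr_right fun hw' => ?_
  rw [← mul_le_mul_iff_right₀ hm, hK, hK, hw, hw', sub_le_sub_iff_right, Nat.cast_le]

theorem Rule.mem_winning_iff_between (φ : Rule) {r : List Bool} (hr : r.length = m)
    (A : Multiset (Finset (Fin m))) {k θ : ℕ}
    (h₁ : (Finset.univ.filter fun c => θ < φ.candPoints r A c).card ≤ k)
    (h₂ : k ≤ ((Finset.univ.filter fun c => θ < φ.candPoints r A c) ∪
      Finset.univ.filter fun c => φ.candPoints r A c = θ).card) (w : Finset (Fin m)) :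
    w ∈ φ.winning A k ↔ w.card = k ∧ (Finset.univ.filter fun c => θ < φ.candPoints r A c) ⊆ w ∧
      w ⊆ (Finset.univ.filter fun c => θ < φ.candPoints r A c) ∪
        Finset.univ.filter fun c => φ.candPoints r A c = θ := by
  rw [φ.mem_winning_iff hr]
  exact and_congr_right fun hw => maximal_iff_between _ θ k h₁ h₂ hw

end Scores

end ApprovalVoting

/-! ### Correctness of the algorithm -/

namespace ApprovalVoting

section Correctness

variable {m t : ℕ}

/-- The candidates above the threshold `θ`. -/
abbrev aboveSet (s : Fin m → ℕ) (θ : ℕ) : Finset (Fin m) := Finset.univ.filter fun c => θ < s c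

/-- The candidates at the threshold `θ`. -/
abbrev levelSet (s : Fin m → ℕ) (θ : ℕ) : Finset (Fin m) := Finset.univ.filter fun c => s c = θ

theorem disjoint_aboveSet_levelSet (s : Fin m → ℕ) (θ : ℕ) :
    Disjoint (aboveSet s θ) (levelSet s θ) := by
  rw [Finset.disjoint_left]
  intro c
  simp
  omega

/-- The satisfaction of a manipulator with truthful vote `v` when `w` is replaced by `w'`. -/
def Improves (sub : Bool) (v w w' : Finset (Fin m)) : Prop :=
  (sub = true → v ∩ w ⊆ w') ∧ (v ∩ w).card < (v ∩ w').card

/-- The condition on a threshold that all winning committees improve on `w` for the vote `v`. -/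
def ThresholdGood (sub : Bool) (s : Fin m → ℕ) (θ : ℕ) (w v : Finset (Fin m)) : Prop :=
  (sub = true → v ∩ w ⊆ aboveSet s θ ∪ levelSet s θ ∧
    (Disjoint (v ∩ w) (levelSet s θ) ∨ (aboveSet s θ).card + (levelSet s θ).card = w.card)) ∧
  ((v ∩ w).card < (v ∩ aboveSet s θ).card ∨
    (v ∩ w).card + (aboveSet s θ).card + (levelSet s θ \ v).card <
      (v ∩ aboveSet s θ).card + w.card)

theorem forall_winning_improves_iff (φ : Rule) (sub : Bool) {r : List Bool} (hr : r.length = m)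
    (A : Multiset (Finset (Fin m))) {θ : ℕ} (w : Finset (Fin m))
    (h₁ : (aboveSet (φ.candPoints r A) θ).card ≤ w.card)
    (h₂ : w.card ≤ (aboveSet (φ.candPoints r A) θ ∪ levelSet (φ.candPoints r A) θ).card)
    (v : Finset (Fin m)) :
    (∀ w' ∈ φ.winning A w.card, Improves sub v w w') ↔
      ThresholdGood sub (φ.candPoints r A) θ w v := by
  have hd := disjoint_aboveSet_levelSet (φ.candPoints r A) θ
  have h₃ := forall_between_subset_iff hd h₁ h₂ (y := v ∩ w)
  have h₄ := forall_between_card_lt_iff hd h₁ h₂ (v := v) (b := (v ∩ w).card)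
  simp only [φ.mem_winning_iff_between hr A h₁ h₂, Improves, ThresholdGood, ← h₃, ← h₄]
  constructor
  · exact fun h => ⟨fun hs w' a b c => (h w' ⟨a, b, c⟩).1 hs, fun w' a b c => (h w' ⟨a, b, c⟩).2⟩
  · exact fun h w' hw' => ⟨fun hs => h.1 hs w' hw'.1 hw'.2.1 hw'.2.2,
      h.2 w' hw'.1 hw'.2.1 hw'.2.2⟩

variable (V VM : List (Finset (Fin m))) (w : Finset (Fin m))

/-- The rows of an instance. -/
abbrev rows : List (List Bool) × List (List Bool) × List Bool := (V.map row, VM.map row, row w)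

theorem approves_rows {i : ℕ} (hi : i < VM.length) (j : Fin m) :
    approves (rows V VM w) i j = decide (j ∈ VM[i]) := by
  unfold approves
  rw [List.getD_eq_getElem (VM.map row) _ (by simpa using hi), List.getElem_map, getD_row]

theorem card_filter_eq_sum (p : Fin m → Bool) (s : Finset (Fin m)) (h : ∀ c, c ∈ s ↔ p c = true) :
    (∑ c, if p c then 1 else 0) = s.card := by
  rw [← Finset.card_filter]
  congr 1
  ext c
  simp [h]

theorem oldCount_rows {i : ℕ} (hi : i < VM.length) :
    oldCount (rows V VM w) i = (VM[i] ∩ w).card := by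
  simp only [oldCount, length_row]
  rw [sum_map_range_fin]
  exact card_filter_eq_sum _ _ fun c => by simp [approves_rows V VM w hi]

/-- With the sizes of the new votes fixed, they enter the score of `j` only through the set of
manipulators approving `j`. This makes the candidates independent in the dynamic program. -/
theorem points_rows (φ : Rule) (u : Fin t → Finset (Fin m)) (j : Fin m) (S : Fin t → Bool)
    (hS : ∀ i, S i = decide (j ∈ u i)) :
    φ.points (rows V VM w) (fun i => (u i).card) j S =
      φ.candPoints (row w) (V + List.ofFn u : Multiset (Finset (Fin m))) j := by
  simp only [Rule.points, Rule.candPoints, Multiset.map_add, Multiset.sum_add, Multiset.map_coe,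
    Multiset.sum_coe, List.map_map, List.map_ofFn, List.sum_ofFn, hS]
  congr 2
  · exact List.map_congr_left fun v _ => by simp
  · funext i
    simp

/-- Summing the indicators over the candidates turns each counter into the cardinality of a set in
the threshold conditions. Nothing is assumed about `θ`; acceptance itself checks that it is a
threshold. -/
theorem accepts_rows_iff (sub : Bool) (hVM : VM.length = t) (u : Fin t → Finset (Fin m))
    (s : Fin m → ℕ) (θ : ℕ) (z : Fin t → ℕ) (S : Fin m → Fin t → Bool)
    (hS : ∀ j i, S j i = decide (j ∈ u i)) (v : Counter t → ℕ)
    (hv : ∀ c, v c = ∑ j : Fin m, if counts (rows V VM w) θ (s j) j (S j) c then 1 else 0) :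
    accepts sub (rows V VM w) z v = true ↔ (aboveSet s θ).card ≤ w.card ∧
      w.card ≤ (aboveSet s θ ∪ levelSet s θ).card ∧ (∀ i, (u i).card = z i) ∧
      ∀ v ∈ VM, ThresholdGood sub s θ w v := by
  subst hVM
  have h₁ : v .above = (aboveSet s θ).card := by
    rw [hv]; exact card_filter_eq_sum _ _ fun c => by simp [counts]
  have h₂ : v .level = (levelSet s θ).card := by
    rw [hv]; exact card_filter_eq_sum _ _ fun c => by simp [counts]
  have h₃ : ∀ i, v (.vote i) = (u i).card := fun i => by
    rw [hv]; exact card_filter_eq_sum _ _ fun c => by simp [counts, hS]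
  have h₄ : ∀ i : Fin VM.length, v (.aboveIn i) = (VM[(i : ℕ)] ∩ aboveSet s θ).card := fun i => by
    rw [hv]; exact card_filter_eq_sum _ _ fun c => by
      simp [counts, approves_rows V VM w i.2]
  have h₅ : ∀ i : Fin VM.length, v (.levelOut i) = (levelSet s θ \ VM[(i : ℕ)]).card := fun i => by
    rw [hv]; exact card_filter_eq_sum _ _ fun c => by
      simp [counts, approves_rows V VM w i.2, and_comm]
  have h₆ : ∀ i : Fin VM.length,
      v (.lostLevel i) = (VM[(i : ℕ)] ∩ w ∩ levelSet s θ).card := fun i => by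
    rw [hv]; exact card_filter_eq_sum _ _ fun c => by
      simp [counts, approves_rows V VM w i.2, and_assoc]
  have h₇ : ∀ i : Fin VM.length, v (.lostBelow i) =
      ((VM[(i : ℕ)] ∩ w) \ (aboveSet s θ ∪ levelSet s θ)).card := fun i => by
    rw [hv]; exact card_filter_eq_sum _ _ fun c => by
      simp [counts, approves_rows V VM w i.2]
      intros
      omega
  have h₈ : ∀ i : Fin VM.length, oldCount (rows V VM w) i = (VM[(i : ℕ)] ∩ w).card := fun i =>
    oldCount_rows V VM w i.2
  have hgood : (∀ i, satisfied sub (rows V VM w) v i = true) ↔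
      ∀ v ∈ VM, ThresholdGood sub s θ w v := by
    rw [List.forall_mem_iff_getElem]
    have hfin : (∀ (i : ℕ) (h : i < VM.length), ThresholdGood sub s θ w VM[i]) ↔
        ∀ i : Fin VM.length, ThresholdGood sub s θ w VM[(i : ℕ)] :=
      ⟨fun h i => h i.1 i.2, fun h i hi => h ⟨i, hi⟩⟩
    rw [hfin]
    refine forall_congr' fun i => ?_
    simp only [satisfied, ThresholdGood, h₁, h₂, h₄, h₅, h₆, h₇, h₈, trues_row,
      Finset.card_eq_zero, Finset.sdiff_eq_empty_iff_subset, Finset.disjoint_iff_inter_eq_empty]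
    cases sub <;> simp [and_comm]
  simp only [accepts, Bool.and_eq_true, decide_eq_true_eq, hgood, h₁, h₂, h₃, trues_row,
    Finset.card_union_of_disjoint (disjoint_aboveSet_levelSet s θ)]
  tauto

theorem solveExact_rows_iff (φ : Rule) (sub : Bool) :
    solveExact φ sub t (rows V VM w) = true ↔ ∃ z : Fin t → ℕ,
      ∃ j₀, j₀ < m ∧ ∃ S₀ : Fin t → Bool, ∃ f : ℕ → Fin t → Bool, ∃ v : Counter t → ℕ,
        (∀ c, v c = ∑ j : Fin m, if counts (rows V VM w) (φ.points (rows V VM w) z j₀ S₀)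
          (φ.points (rows V VM w) z j (f j)) j (f j) c then 1 else 0) ∧
        accepts sub (rows V VM w) z v = true := by
  have hrange : ∀ n, n ∈ List.range (false :: row w).length ↔ n ≤ m := by
    intro n
    rw [List.mem_range, List.length_cons, length_row]
    omega
  have hreach := fun (δ : ℕ → (Fin t → Bool) → Counter t → ℕ) (hδ : ∀ j S c, δ j S c ≤ 1) v =>
    mem_reach (m := m) (all := allFun (List.range (false :: row w).length)
      (Finset.univ : Finset (Counter t)).toList) (choices :=
      (Finset.univ : Finset (Fin t → Bool)).toList) (δ := δ)
      (fun v hv => mem_allFun _ (fun c _ => (hrange _).2 (hv c)) (by simp)) (by simp) hδ (v := v)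
  unfold solveExact
  simp only [List.any_eq_true, length_row, List.mem_range, Finset.mem_toList, Finset.mem_univ,
    true_and]
  constructor
  · rintro ⟨z, -, j₀, hj₀, S₀, v, hv, h⟩
    obtain ⟨f, hf⟩ := (hreach _ (fun j S c => by split_ifs <;> simp) v).1 hv
    exact ⟨z, j₀, hj₀, S₀, f, v, fun c => by rw [hf, Finset.sum_range], h⟩
  · rintro ⟨z, j₀, hj₀, S₀, f, v, hf, h⟩
    -- Acceptance equates `z i` with a counter, a sum of `m` terms that are 0 or 1, so the bounded
    -- search finds it.
    have hz : ∀ i, z i ≤ m := fun i => by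
      simp only [accepts, Bool.and_eq_true, decide_eq_true_eq] at h
      rw [← h.1.2 i, hf]
      refine (Finset.sum_le_card_nsmul _ _ 1 fun j _ => by split_ifs <;> simp).trans ?_
      simp
    refine ⟨z, mem_allFun _ (fun i _ => (hrange _).2 (hz i)) (by simp), j₀, hj₀, S₀, v,
      (hreach _ (fun j S c => by split_ifs <;> simp) v).2 ⟨f, fun c => ?_⟩, h⟩
    rw [hf, Finset.sum_range]

theorem solveExact_rows_iff_exists (φ : Rule) (sub : Bool) (hVM : VM.length = t) (ht : t ≠ 0) :
    solveExact φ sub t (rows V VM w) = true ↔ ∃ u : Fin t → Finset (Fin m),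
      ∀ v ∈ VM, ∀ w' ∈ φ.winning (V + List.ofFn u : Multiset (Finset (Fin m))) w.card,
        Improves sub v w w' := by
  rw [solveExact_rows_iff V VM w φ sub]
  constructor
  · rintro ⟨z, j₀, -, S₀, f, v, hv, h⟩
    -- The choices made candidate by candidate are read as votes. The guess `j₀`, `S₀` need not
    -- agree with them, because any number passing the threshold test will do.
    let u : Fin t → Finset (Fin m) := fun i => Finset.univ.filter fun j => f j i = true
    have hf : ∀ (j : Fin m) i, f j i = decide (j ∈ u i) := fun j i => by simp [u]
    have h' := (accepts_rows_iff V VM w sub hVM u _ _ z (fun j => f j) hf v hv).1 h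
    obtain rfl : (fun i => (u i).card) = z := funext h'.2.2.1
    have hp : (fun j : Fin m => φ.points (rows V VM w) (fun i => (u i).card) j (f j)) =
        φ.candPoints (row w) (V + List.ofFn u : Multiset (Finset (Fin m))) :=
      funext fun j => points_rows V VM w φ u j (f j) (hf j)
    rw [hp] at h'
    exact ⟨u, fun v hv => (forall_winning_improves_iff φ sub (length_row w) _ w h'.1 h'.2.1 v).2
      (h'.2.2.2 v hv)⟩
  · rintro ⟨u, hu⟩
    set A : Multiset (Finset (Fin m)) := V + List.ofFn u with hA
    -- Without candidates `w` would be winning again and could not improve on itself for the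
    -- existing manipulator.
    have hm : m ≠ 0 := by
      rintro rfl
      obtain ⟨v, hv⟩ := List.exists_mem_of_length_pos (by omega : 0 < VM.length)
      have := (hu v hv w (by
        rw [φ.mem_winning_iff (length_row w)]
        exact ⟨rfl, fun w' _ => by rw [Subsingleton.elim w' w]⟩)).2
      omega
    have : Nonempty (Fin m) := ⟨⟨0, by omega⟩⟩
    obtain ⟨c₀, h₁, h₂⟩ := exists_threshold (φ.candPoints (row w) A) (Finset.card_le_univ w)
    let f : ℕ → Fin t → Bool := fun j i => if h : j < m then decide (⟨j, h⟩ ∈ u i) else false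
    have hf : ∀ (j : Fin m) i, f j i = decide (j ∈ u i) := fun j i => by simp [f]
    have hp : (fun j : Fin m => φ.points (rows V VM w) (fun i => (u i).card) j (f j)) =
        φ.candPoints (row w) A :=
      funext fun j => points_rows V VM w φ u j (f j) (hf j)
    -- The threshold is guessed through `c₀` together with the manipulators who approve it in the
    -- new votes.
    refine ⟨fun i => (u i).card, c₀, c₀.2, f c₀,
      f, _, fun c => rfl, ?_⟩
    rw [accepts_rows_iff V VM w sub hVM u _ _ _ (fun j => f j) hf _ fun c => rfl, hp,
      congrFun hp c₀]
    exact ⟨h₁, h₂, fun _ => rfl, fun v hv =>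
      (forall_winning_improves_iff φ sub (length_row w) _ w h₁ h₂ v).1 (hu v hv)⟩

theorem solve_rows_iff (φ : Rule) (sub : Bool) (hVM : VM.length ≤ t) :
    solve φ sub t (rows V VM w) = true ↔ ∃ U : Multiset (Finset (Fin m)), U.card = VM.length ∧
      ∀ w' ∈ φ.winning ((V : Multiset (Finset (Fin m))) + U) w.card, ∀ v ∈ VM,
        Improves sub v w w' := by
  induction t with
  | zero =>
    have : VM = [] := List.eq_nil_of_length_eq_zero (by omega)
    subst this
    -- Without manipulators the condition on the winning committees is vacuous.
    simp [solve]
  | succ t ih =>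
    have hs : solve φ sub (t + 1) (rows V VM w) = if decide ((VM.map row).length = t + 1)
      then solveExact φ sub (t + 1) (rows V VM w) else solve φ sub t (rows V VM w) := rfl
    rw [hs, List.length_map]
    by_cases h : VM.length = t + 1
    · simp only [h, decide_true, if_true]
      rw [solveExact_rows_iff_exists V VM w φ sub h (by omega)]
      constructor
      · rintro ⟨u, hu⟩
        exact ⟨List.ofFn u, by simp, fun w' hw' v hv => hu v hv w' hw'⟩
      · rintro ⟨U, hU, h'⟩
        obtain ⟨l, rfl⟩ : ∃ l : List (Finset (Fin m)), (l : Multiset (Finset (Fin m))) = U :=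
          Quot.exists_rep U
        have hl : ∀ n, l.length = n → ∃ u : Fin n → Finset (Fin m), List.ofFn u = l := by
          rintro _ rfl
          exact ⟨l.get, List.ofFn_get l⟩
        obtain ⟨u, rfl⟩ := hl (t + 1) (by simpa using hU)
        exact ⟨u, fun v hv w' hw' => h' w' hw' v hv⟩
    · simp only [h, decide_false, Bool.false_eq_true, if_false]
      exact ih (by omega)

end Correctness

theorem improves_false_iff {m : ℕ} (v w w' : Finset (Fin m)) :
    Improves false v w w' ↔ (v ∩ w).card < (v ∩ w').card := by
  simp [Improves]

/-- For nested finite sets strictness is a comparison of cardinalities, so both problems share the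
cardinality test and differ only by the inclusion. -/
theorem improves_true_iff {m : ℕ} (v w w' : Finset (Fin m)) :
    Improves true v w w' ↔ v ∩ w ⊂ v ∩ w' := by
  constructor
  · rintro ⟨h, h'⟩
    refine Finset.ssubset_iff_subset_ne.2 ⟨Finset.subset_inter Finset.inter_subset_left (h rfl), ?_⟩
    intro he
    rw [he] at h'
    omega
  · intro h
    exact ⟨fun _ => h.1.trans Finset.inter_subset_right, Finset.card_lt_card h⟩

end ApprovalVoting

theorem mainTheorem9 (φ : ApprovalVoting.Rule) (t : ℕ) :
    ApprovalVoting.PolyTimeSolvable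
        (fun I : {I : ApprovalVoting.ManipulationInstance φ // I.VM.length ≤ t} => I.1.encode)
        (fun I => I.1.CBCM) ∧
      ApprovalVoting.PolyTimeSolvable
        (fun I : {I : ApprovalVoting.ManipulationInstance φ // I.VM.length ≤ t} => I.1.encode)
        (fun I => I.1.SBCM) := by
  constructor
  · refine ((ApprovalVoting.polyFun_solve φ false t).comp
      ApprovalVoting.polyFun_parse).polyTimeSolvable fun I => ?_
    rw [ApprovalVoting.parse_encode, ApprovalVoting.solve_rows_iff _ _ _ φ false I.2]
    simp only [ApprovalVoting.improves_false_iff]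
    rfl
  · refine ((ApprovalVoting.polyFun_solve φ true t).comp
      ApprovalVoting.polyFun_parse).polyTimeSolvable fun I => ?_
    rw [ApprovalVoting.parse_encode, ApprovalVoting.solve_rows_iff _ _ _ φ true I.2]
    simp only [ApprovalVoting.improves_true_iff]
    rfl
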